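/- Let $k\ge 1$ be an odd integer, let $\nu\in\mathbb C$ with $\Re(\nu)>0$, and let $a,x>0$ be real. Here $K_\nu$ is the modified Bessel function, $K_\nu(z)=\frac{\pi}{2}\,\frac{I_{-\nu}(z)-I_\nu(z)}{\sin \pi\nu}$ for $\nu\notin\mathbb Z$ (and its limit in the order for $\nu\in\mathbb Z$), with $I_\nu(z)=\sum_{n\ge 0}\frac{(z/2)^{\nu+2n}}{n!\,\Gamma(\nu+n+1)}$. (1) For all real $0<\theta<1$ and $0<\psi<1$, $$\left(\frac{a^2x}{4}\right)^{\frac{\nu}{2}+k+1}\sum_{n=1}^{\infty} n^{\nu/2}K_\nu(a\sqrt{nx})\sum_{d\mid n}d^k\sin(2\pi d\theta)\sin\left(\frac{2\pi n\psi}{d}\right)$$ $$=-\frac{(-1)^{\frac{k+1}{2}}(2\pi)^{k+1}}{8}\,\Gamma(\nu+k+1)\sum_{m,n\ge 0}\Big\{T(n+\psi,m+\theta)-T(n+1-\psi,m+\theta)-T(n+\psi,m+1-\theta)+T(n+1-\psi,m+1-\theta)\Big\},$$ where $$T(u,v)=\frac{u^k}{\left(\frac{16\pi^2}{a^2}\frac{uv}{x}+1\right)^{\nu+k+1}},$$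 and both the series on the left and the double series on the right converge absolutely. (2) For these fixed $k,\nu,a,x$, the validity of (1) for all $\theta,\psi\in(0,1)$ is equivalent to the following: for all integers $p,q\ge 1$ and all odd primitive Dirichlet characters $\chi_1$ modulo $p$ and $\chi_2$ modulo $q$, $$\left(\frac{a^2x}{4}\right)^{\frac{\nu}{2}+k+1}\sum_{n=1}^{\infty}\sigma_{k,\chi_1,\chi_2}(n)\,n^{\nu/2}K_\nu(a\sqrt{nx})=\frac{(-1)^{\frac{k+1}{2}}}{2p}\left(\frac{2\pi}{q}\right)^{k+1}\tau(\chi_1)\tau(\chi_2)\sum_{n=1}^{\infty}\sigma_{k,\overline{\chi_2},\overline{\chi_1}}(n)\,\frac{\Gamma(\nu+k+1)}{\left(\frac{16\pi^2}{a^2pq}\frac{n}{x}+1\right)^{\nu+k+1}},$$ with both series absolutely convergent, where $\sigma_{k,\chi_1,\chi_2}(n)=\sum_{d\mid n}d^k\chi_1(d)\chi_2(n/d)$ and $\tau(\chi)=\sum_{h=1}^{q}\chi(h)e^{2\pi i h/q}$ for $\chi$ modulo $q$. -/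

import Mathlib

open Filter Topology

noncomputable section

/-- The modified Bessel function of the first kind,
`I_ν(z) = ∑_{n ≥ 0} (z/2)^(ν+2n) / (n! Γ(ν+n+1))` (principal branch of the power).
Mathlib's `Complex.Gamma` vanishes at the poles of the Gamma function, so that the terms with
`ν + n + 1 ∈ {0, -1, -2, …}` are zero, as they should be. -/
def besselI (ν z : ℂ) : ℂ :=
  ∑' n : ℕ, (z / 2) ^ (ν + 2 * (n : ℂ)) / ((n.factorial : ℂ) * Complex.Gamma (ν + n + 1))

/-- The quotient `(π/2) (I_{-ν}(z) - I_ν(z)) / sin (π ν)`, meaningful for `ν ∉ ℤ`. -/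
def besselKQuot (ν z : ℂ) : ℂ :=
  (Real.pi : ℂ) / 2 * ((besselI (-ν) z - besselI ν z) / Complex.sin ((Real.pi : ℂ) * ν))

open Classical in
/-- The modified Bessel function `K_ν(z)`: the quotient `(π/2) (I_{-ν}(z) - I_ν(z)) / sin (π ν)`
for `ν ∉ ℤ`, and its limit in the order for `ν ∈ ℤ`. -/
def besselK (ν z : ℂ) : ℂ :=
  if ∃ j : ℤ, ν = j then limUnder (𝓝[≠] ν) (fun μ : ℂ => besselKQuot μ z)
  else besselKQuot ν z

/-- The weighted divisor sum `∑_{d ∣ n} d^k sin(2πdθ) sin(2πnψ/d)`. -/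
def sinSinDivisorSum (k : ℕ) (θ ψ : ℝ) (n : ℕ) : ℝ :=
  ∑ d ∈ n.divisors, (d : ℝ) ^ k * Real.sin (2 * Real.pi * (d : ℝ) * θ) *
    Real.sin (2 * Real.pi * (n : ℝ) * ψ / (d : ℝ))

/-- The building block `u^k / ((16π²/a²) (u v / x) + 1)^(ν+k+1)` of the double series. -/
def rieszTerm (k : ℕ) (ν : ℂ) (a x u v : ℝ) : ℂ :=
  ((u ^ k : ℝ) : ℂ) /
    ((16 * Real.pi ^ 2 / a ^ 2 * (u * v / x) + 1 : ℝ) : ℂ) ^ (ν + (k : ℂ) + 1)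

/-- The term of index `(m, n)` of the signed double series. -/
def signedTerm (k : ℕ) (ν : ℂ) (a x θ ψ : ℝ) (m n : ℕ) : ℂ :=
  rieszTerm k ν a x (n + ψ) (m + θ) - rieszTerm k ν a x (n + 1 - ψ) (m + θ)
    - rieszTerm k ν a x (n + ψ) (m + 1 - θ) + rieszTerm k ν a x (n + 1 - ψ) (m + 1 - θ)

/-- The identity with two sines at the parameters `θ`, `ψ`: both series converge (absolutely),
and the two sides agree. -/
def SineIdentity (k : ℕ) (ν : ℂ) (a x θ ψ : ℝ) : Prop :=
  Summable (fun n : ℕ+ => ((n : ℕ) : ℂ) ^ (ν / 2) *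
      besselK ν ((a * Real.sqrt ((n : ℕ) * x) : ℝ) : ℂ) * (sinSinDivisorSum k θ ψ n : ℂ)) ∧
  Summable (fun i : ℕ × ℕ => signedTerm k ν a x θ ψ i.1 i.2) ∧
  ((a ^ 2 * x / 4 : ℝ) : ℂ) ^ (ν / 2 + (k : ℂ) + 1) *
      ∑' n : ℕ+, ((n : ℕ) : ℂ) ^ (ν / 2) *
        besselK ν ((a * Real.sqrt ((n : ℕ) * x) : ℝ) : ℂ) * (sinSinDivisorSum k θ ψ n : ℂ)
    = -((-1) ^ ((k + 1) / 2) / 8) * (2 * (Real.pi : ℂ)) ^ (k + 1) *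
        Complex.Gamma (ν + (k : ℂ) + 1) *
        ∑' i : ℕ × ℕ, signedTerm k ν a x θ ψ i.1 i.2

/-- The twisted divisor sum `σ_{k,χ₁,χ₂}(n) = ∑_{d ∣ n} d^k χ₁(d) χ₂(n/d)`. -/
def twistedSigma (k : ℕ) {p q : ℕ} (χ₁ : DirichletCharacter ℂ p) (χ₂ : DirichletCharacter ℂ q)
    (n : ℕ) : ℂ :=
  ∑ d ∈ n.divisors, (d : ℂ) ^ k * χ₁ (d : ZMod p) * χ₂ ((n / d : ℕ) : ZMod q)

/-- The Gauss sum `τ(χ) = ∑_{h mod q} χ(h) e^{2πih/q}`. -/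
def tauSum {q : ℕ} [NeZero q] (χ : DirichletCharacter ℂ q) : ℂ :=
  gaussSum χ (ZMod.stdAddChar (N := q))

/-- The character analogue, for two characters `χ₁` mod `p` and `χ₂` mod `q`; `star χ` is the
complex conjugate character. -/
def CharacterIdentity (k : ℕ) (ν : ℂ) (a x : ℝ) {p q : ℕ} [NeZero p] [NeZero q]
    (χ₁ : DirichletCharacter ℂ p) (χ₂ : DirichletCharacter ℂ q) : Prop :=
  Summable (fun n : ℕ+ => twistedSigma k χ₁ χ₂ n * ((n : ℕ) : ℂ) ^ (ν / 2) *
      besselK ν ((a * Real.sqrt ((n : ℕ) * x) : ℝ) : ℂ)) ∧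
  Summable (fun n : ℕ+ => twistedSigma k (star χ₂) (star χ₁) n *
      (Complex.Gamma (ν + (k : ℂ) + 1) /
        ((16 * Real.pi ^ 2 / (a ^ 2 * p * q) * ((n : ℕ) / x) + 1 : ℝ) : ℂ)
          ^ (ν + (k : ℂ) + 1))) ∧
  ((a ^ 2 * x / 4 : ℝ) : ℂ) ^ (ν / 2 + (k : ℂ) + 1) *
      ∑' n : ℕ+, twistedSigma k χ₁ χ₂ n * ((n : ℕ) : ℂ) ^ (ν / 2) *
        besselK ν ((a * Real.sqrt ((n : ℕ) * x) : ℝ) : ℂ)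
    = (-1) ^ ((k + 1) / 2) / (2 * (p : ℂ)) * (2 * (Real.pi : ℂ) / (q : ℂ)) ^ (k + 1) *
        tauSum χ₁ * tauSum χ₂ *
        ∑' n : ℕ+, twistedSigma k (star χ₂) (star χ₁) n *
          (Complex.Gamma (ν + (k : ℂ) + 1) /
            ((16 * Real.pi ^ 2 / (a ^ 2 * p * q) * ((n : ℕ) / x) + 1 : ℝ) : ℂ)
              ^ (ν + (k : ℂ) + 1))

end

/-! Put A = a²x/4. The integral M_ν(y) = ∫₀^∞ t^(ν-1) e^(-t-y/t) dt represents K_ν (`besselK_eq`),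
and n^(ν/2) K_ν(a√(nx)) is M_ν(An) up to a constant factor independent of n. Writing n = rd, the
Bessel series becomes the integral against t^(ν-1) e^(-t) of D(A/t), where D(s) = ∑ d^k sin(2πdθ)
sin(2πrψ) e^(-srd) over r, d ≥ 1. On the other side, a Gamma integral expresses Γ(ν+k+1) T(u,v) as
the integral of u^k e^(-ctuv) against t^(ν+k) e^(-t), with c = 4π²/A. Both exchanges of sum and
integral are absolutely convergent, so everything reduces to `tsum_signedShift_expTerm_eq`, a
modular-type relation between D(4π²/c) and the signed sum of u^k e^(-cuv).

That relation is Poisson summation in u. Summing the signed exponentials over v = m + θ and v = m +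
1 - θ gives geometric series, hence a kernel g(u) that is odd because k is odd; oddness merges the
shifts n + ψ and n + 1 - ψ into ∑ g(ψ + n) over all integers n. Expanding g back into exponentials,
its Fourier transform is a sum of inverse (k+1)-st powers over shifted integers, and the Lipschitz
formula turns it into a damped sine series in θ (`fourier_sineKernel_eq`).

For characters, the sine identity is taken at θ = h/p, ψ = j/q and summed with weights χ₁⁻¹(h)
χ₂⁻¹(j). Primitivity lets Gauss sums convert the sines into χ₁ and χ₂, and oddness makes the four
signed terms contribute equally. The converse half of the equivalence needs no inversion over
characters: the sine identity is established outright. -/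

noncomputable section

open Complex Set MeasureTheory
open scoped FourierTransform

/-! ### The power series of I_ν as a function of order and argument -/

/-- The entire part of the Bessel functions: `besselI ν z = (z/2)^ν * besselR ν (z²/4)`. -/
def besselR (μ y : ℂ) : ℂ :=
  ∑' n : ℕ, y ^ n / ((n.factorial : ℂ) * Gamma (μ + n + 1))

/-- For n up to some N ≥ ρ this is compactness. Beyond N, 1/Γ(s) = s · 1/Γ(s+1) with s = μ + n + 1
and |s| ≥ 1, so the bound propagates from n to n + 1. Uniformity in n and μ is what permits termwise
differentiation in both the argument and the order. -/
lemma exists_bound_inv_Gamma (ρ : ℝ) :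
    ∃ M : ℝ, 0 ≤ M ∧ ∀ (n : ℕ) (μ : ℂ), ‖μ‖ ≤ ρ → ‖(Gamma (μ + n + 1))⁻¹‖ ≤ M := by
  have h1 : ∀ n : ℕ, ∃ M : ℝ, ∀ μ : ℂ, ‖μ‖ ≤ ρ → ‖(Gamma (μ + n + 1))⁻¹‖ ≤ M := by
    intro n
    have hc : Continuous fun μ : ℂ => (Gamma (μ + n + 1))⁻¹ :=
      differentiable_one_div_Gamma.continuous.comp (by fun_prop)
    obtain ⟨M, hM⟩ := (isCompact_closedBall (0 : ℂ) ρ).exists_bound_of_continuousOn hc.continuousOn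
    exact ⟨M, fun μ hμ => hM μ (by simpa using hμ)⟩
  have h2 : ∀ N : ℕ, ∃ M : ℝ, ∀ n ≤ N, ∀ μ : ℂ, ‖μ‖ ≤ ρ → ‖(Gamma (μ + n + 1))⁻¹‖ ≤ M := by
    intro N
    induction N with
    | zero =>
      obtain ⟨M, hM⟩ := h1 0
      exact ⟨M, fun n hn => by obtain rfl : n = 0 := by omega
                               exact hM⟩
    | succ N ih =>
      obtain ⟨M, hM⟩ := h1 (N + 1)
      obtain ⟨M', hM'⟩ := ih
      refine ⟨max M M', fun n hn μ hμ => ?_⟩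
      rcases Nat.lt_or_eq_of_le hn with h | h
      · exact (hM' n (by omega) μ hμ).trans (le_max_right _ _)
      · subst h
        exact (hM μ hμ).trans (le_max_left _ _)
  obtain ⟨N, hN⟩ := exists_nat_ge ρ
  obtain ⟨M, hM⟩ := h2 N
  have h3 : ∀ (n : ℕ) (μ : ℂ), ‖μ‖ ≤ ρ → ‖(Gamma (μ + n + 1))⁻¹‖ ≤ M := by
    intro n μ hμ
    rcases le_total n N with h | h
    · exact hM n h μ hμ
    · induction n, h using Nat.le_induction with
      | base => exact hM N le_rfl μ hμ
      | succ n hn ih =>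
        rw [one_div_Gamma_eq_self_mul_one_div_Gamma_add_one, norm_mul] at ih
        have h4 : 1 ≤ ‖μ + n + 1‖ := by
          have h5 := norm_sub_norm_le ((n : ℂ) + 1) (-μ)
          rw [show (n : ℂ) + 1 - -μ = μ + n + 1 by ring, norm_neg] at h5
          have h6 : ‖(n : ℂ) + 1‖ = n + 1 := by
            rw [← Nat.cast_succ, Complex.norm_natCast]; push_cast; ring
          have h7 : (N : ℝ) ≤ n := by exact_mod_cast hn
          rw [h6] at h5
          linarith
        push_cast
        rw [show μ + (n + 1) + 1 = μ + n + 1 + 1 by ring]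
        nlinarith [norm_nonneg (Gamma (μ + n + 1 + 1))⁻¹]
  exact ⟨max M 0, le_max_right _ _, fun n μ hμ => (h3 n μ hμ).trans (le_max_left _ _)⟩

lemma norm_besselR_term_le {M : ℝ} {n : ℕ} {μ y : ℂ} (h : ‖(Gamma (μ + n + 1))⁻¹‖ ≤ M) :
    ‖y ^ n / ((n.factorial : ℂ) * Gamma (μ + n + 1))‖ ≤ M * (‖y‖ ^ n / n.factorial) := by
  rw [div_eq_mul_inv, mul_inv, norm_mul, norm_mul, norm_pow, norm_inv, Complex.norm_natCast,
    mul_comm M, ← mul_assoc, ← div_eq_mul_inv]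
  gcongr

lemma summable_besselR (μ y : ℂ) :
    Summable fun n : ℕ => y ^ n / ((n.factorial : ℂ) * Gamma (μ + n + 1)) := by
  obtain ⟨M, -, hM⟩ := exists_bound_inv_Gamma ‖μ‖
  exact Summable.of_norm_bounded ((Real.summable_pow_div_factorial ‖y‖).mul_left M)
    fun n => norm_besselR_term_le (hM n μ le_rfl)

lemma differentiable_besselR_order (y : ℂ) : Differentiable ℂ fun μ => besselR μ y := by
  intro μ
  obtain ⟨M, -, hM⟩ := exists_bound_inv_Gamma (‖μ‖ + 1)
  have h := differentiableOn_tsum_of_summable_norm (U := Metric.ball (0 : ℂ) (‖μ‖ + 1))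
    (F := fun (n : ℕ) μ => y ^ n / ((n.factorial : ℂ) * Gamma (μ + n + 1)))
    ((Real.summable_pow_div_factorial ‖y‖).mul_left M) ?_ Metric.isOpen_ball
    (fun n w hw => norm_besselR_term_le (hM n w (by simpa using (Metric.mem_ball.1 hw).le)))
  · exact h.differentiableAt (Metric.isOpen_ball.mem_nhds (by simp))
  · intro n
    apply Differentiable.differentiableOn
    simp only [div_eq_mul_inv, mul_inv]
    have : Differentiable ℂ fun μ : ℂ => (Gamma (μ + n + 1))⁻¹ :=
      differentiable_one_div_Gamma.comp (by fun_prop)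
    fun_prop

lemma summable_nat_mul_pow_div_factorial (ρ : ℝ) :
    Summable fun n : ℕ => (n * ρ ^ (n - 1)) / n.factorial := by
  rw [← summable_nat_add_iff 1]
  refine (Real.summable_pow_div_factorial ρ).congr fun n => ?_
  rw [Nat.factorial_succ]
  have : (n.factorial : ℝ) ≠ 0 := by positivity
  push_cast
  field_simp

lemma norm_besselR_deriv_term_le {M ρ : ℝ} {n : ℕ} {μ y : ℂ}
    (h : ‖(Gamma (μ + n + 1))⁻¹‖ ≤ M) (hy : ‖y‖ ≤ ρ) :
    ‖(n * y ^ (n - 1)) / ((n.factorial : ℂ) * Gamma (μ + n + 1))‖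
      ≤ M * ((n * ρ ^ (n - 1)) / n.factorial) := by
  have hρ : 0 ≤ ρ := (norm_nonneg y).trans hy
  rw [div_eq_mul_inv, mul_inv, norm_mul, norm_mul, norm_mul, norm_pow, norm_inv,
    Complex.norm_natCast, Complex.norm_natCast, mul_comm M, ← mul_assoc, ← div_eq_mul_inv]
  gcongr

lemma tsum_besselR_deriv (μ y : ℂ) :
    ∑' n : ℕ, (n * y ^ (n - 1)) / ((n.factorial : ℂ) * Gamma (μ + n + 1))
      = besselR (μ + 1) y := by
  obtain ⟨M, hM0, hM⟩ := exists_bound_inv_Gamma ‖μ‖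
  have hs : Summable fun n : ℕ =>
      (n * y ^ (n - 1)) / ((n.factorial : ℂ) * Gamma (μ + n + 1)) :=
    Summable.of_norm_bounded ((summable_nat_mul_pow_div_factorial ‖y‖).mul_left M)
      fun n => norm_besselR_deriv_term_le (hM n μ le_rfl) le_rfl
  rw [hs.tsum_eq_zero_add]
  simp only [besselR, Nat.cast_zero, zero_mul, zero_div, zero_add]
  refine tsum_congr fun n => ?_
  rw [Nat.factorial_succ]
  push_cast
  have h1 : (n : ℂ) + 1 ≠ 0 := by exact_mod_cast n.succ_ne_zero
  rw [show μ + 1 + n + 1 = μ + (n + 1) + 1 by ring, mul_assoc,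
    mul_div_mul_left _ _ h1]

lemma hasDerivAt_besselR (μ y : ℂ) : HasDerivAt (besselR μ) (besselR (μ + 1) y) y := by
  obtain ⟨M, hM0, hM⟩ := exists_bound_inv_Gamma ‖μ‖
  have h := hasDerivAt_tsum_of_isPreconnected (𝕜 := ℂ) (t := Metric.ball (0 : ℂ) (‖y‖ + 1))
    (g := fun (n : ℕ) y => y ^ n / ((n.factorial : ℂ) * Gamma (μ + n + 1)))
    (g' := fun (n : ℕ) y => (n * y ^ (n - 1)) / ((n.factorial : ℂ) * Gamma (μ + n + 1)))
    (y₀ := y) (y := y) ((summable_nat_mul_pow_div_factorial (‖y‖ + 1)).mul_left M)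
    Metric.isOpen_ball (convex_ball _ _).isPreconnected
    (fun n z _ => (hasDerivAt_pow n z).div_const _)
    (fun n z hz => norm_besselR_deriv_term_le (hM n μ le_rfl)
      (by simpa using (Metric.mem_ball.1 hz).le))
    (by simp) (summable_besselR μ y) (by simp)
  rw [tsum_besselR_deriv] at h
  exact h

lemma besselR_zero (μ : ℂ) : besselR μ 0 = (Gamma (μ + 1))⁻¹ := by
  rw [besselR, tsum_eq_single 0 (fun n hn => by simp [hn])]
  simp

/-- Comparison of coefficients through 1/Γ(s) = s/Γ(s+1), which also holds at the poles of Γ when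
1/Γ is read as 0; hence no restriction on the order. -/
lemma besselR_recurrence (μ y : ℂ) :
    y * besselR (μ + 1) y + μ * besselR μ y = besselR (μ - 1) y := by
  have h1 := summable_besselR μ y
  have h2 := summable_besselR (μ + 1) y
  have h3 := summable_besselR (μ - 1) y
  have h1' := (summable_nat_add_iff 1).2 h1
  unfold besselR
  rw [h1.tsum_eq_zero_add, h3.tsum_eq_zero_add, mul_add, ← tsum_mul_left, ← tsum_mul_left,
    add_left_comm, ← (h2.mul_left y).tsum_add (h1'.mul_left μ)]
  have hG : ∀ s : ℂ, (Gamma s)⁻¹ = s * (Gamma (s + 1))⁻¹ :=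
    one_div_Gamma_eq_self_mul_one_div_Gamma_add_one
  congr 1
  · simp only [pow_zero, Nat.factorial_zero, Nat.cast_one, Nat.cast_zero, one_mul, one_div,
      add_zero, sub_add_cancel]
    rw [hG μ]
  · refine tsum_congr fun n => ?_
    rw [Nat.factorial_succ]
    push_cast
    have h4 := hG (μ + n + 1)
    have h5 : (n : ℂ) + 1 ≠ 0 := by exact_mod_cast n.succ_ne_zero
    have h6 : (n.factorial : ℂ) ≠ 0 := by exact_mod_cast n.factorial_ne_zero
    rw [show μ + 1 + n + 1 = μ + n + 1 + 1 by ring, show μ + (n + 1) + 1 = μ + n + 1 + 1 by ring,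
      show μ - 1 + (n + 1) + 1 = μ + n + 1 by ring]
    simp only [div_eq_mul_inv, mul_inv]
    rw [h4]
    field_simp
    ring

/-! ### The Mellin integral of K_ν -/

/-- The integral `∫_0^∞ t^(ν-1) exp (-(t + y/t)) dt`, equal to `2 (z/2)^ν K_ν(z)` with
`y = z²/4`. -/
def besselMellin (ν : ℂ) (y : ℝ) : ℂ :=
  mellin (fun t : ℝ => ((Real.exp (-(t + y / t)) : ℝ) : ℂ)) ν

lemma locallyIntegrableOn_exp_neg_add_div (y : ℝ) :
    LocallyIntegrableOn (fun t : ℝ => ((Real.exp (-(t + y / t)) : ℝ) : ℂ)) (Ioi 0) := by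
  refine ContinuousOn.locallyIntegrableOn ?_ measurableSet_Ioi
  refine continuous_ofReal.comp_continuousOn (Real.continuous_exp.comp_continuousOn ?_)
  exact (continuousOn_id.add (continuousOn_const.div continuousOn_id
    fun t ht => (mem_Ioi.1 ht).ne')).neg

lemma isBigO_exp_neg_add_div_atTop {y : ℝ} (hy : 0 ≤ y) (a : ℝ) :
    (fun t : ℝ => ((Real.exp (-(t + y / t)) : ℝ) : ℂ)) =O[atTop] (· ^ (-a)) := by
  refine Asymptotics.IsBigO.trans ?_ (isLittleO_exp_neg_mul_rpow_atTop one_pos (-a)).isBigO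
  refine Asymptotics.IsBigO.of_bound 1 ?_
  filter_upwards [eventually_gt_atTop 0] with t ht
  rw [Complex.norm_real, Real.norm_eq_abs, Real.norm_eq_abs, Real.abs_exp, Real.abs_exp, one_mul,
    Real.exp_le_exp]
  have : 0 ≤ y / t := by positivity
  linarith

lemma isBigO_exp_neg_add_div_zero {y : ℝ} (hy : 0 < y) (b : ℝ) :
    (fun t : ℝ => ((Real.exp (-(t + y / t)) : ℝ) : ℂ)) =O[𝓝[>] 0] (· ^ (-b)) := by
  have h := (isLittleO_exp_neg_mul_rpow_atTop hy b).isBigO.comp_tendsto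
    (tendsto_inv_nhdsGT_zero (𝕜 := ℝ))
  refine Asymptotics.IsBigO.trans ?_ (h.trans (Asymptotics.IsBigO.of_bound 1 ?_))
  · refine Asymptotics.IsBigO.of_bound 1 ?_
    filter_upwards [self_mem_nhdsWithin] with t ht
    have ht' : 0 < t := ht
    rw [Complex.norm_real, Real.norm_eq_abs, Function.comp_apply, Real.norm_eq_abs, Real.abs_exp,
      Real.abs_exp, one_mul, Real.exp_le_exp, ← div_eq_mul_inv, neg_div]
    linarith
  · filter_upwards [self_mem_nhdsWithin] with t ht
    have ht' : 0 < t := ht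
    rw [Function.comp_apply, Real.inv_rpow ht'.le, Real.rpow_neg ht'.le, one_mul]

lemma mellinConvergent_exp_neg_add_div {y : ℝ} (hy : 0 < y) (ν : ℂ) :
    MellinConvergent (fun t : ℝ => ((Real.exp (-(t + y / t)) : ℝ) : ℂ)) ν :=
  mellinConvergent_of_isBigO_rpow (locallyIntegrableOn_exp_neg_add_div y)
    (isBigO_exp_neg_add_div_atTop hy.le (ν.re + 1)) (by linarith)
    (isBigO_exp_neg_add_div_zero hy (ν.re - 1)) (by linarith)

lemma differentiable_besselMellin {y : ℝ} (hy : 0 < y) :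
    Differentiable ℂ fun ν => besselMellin ν y := fun ν =>
  mellin_differentiableAt_of_isBigO_rpow (locallyIntegrableOn_exp_neg_add_div y)
    (isBigO_exp_neg_add_div_atTop hy.le (ν.re + 1)) (by linarith)
    (isBigO_exp_neg_add_div_zero hy (ν.re - 1)) (by linarith)

/-- The substitution t ↦ y/t, carried out as a scaling followed by an inversion; it encodes the
symmetry K_ν = K_{-ν}. -/
lemma besselMellin_eq_cpow_mul {y : ℝ} (hy : 0 < y) (ν : ℂ) :
    besselMellin ν y = (y : ℂ) ^ ν * besselMellin (-ν) y := by
  have h1 := mellin_comp_mul_left (fun t : ℝ => ((Real.exp (-(t + y / t)) : ℝ) : ℂ)) (-ν) hy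
  have h2 := mellin_comp_inv (fun t : ℝ => ((Real.exp (-(y * t + y / (y * t))) : ℝ) : ℂ)) ν
  rw [neg_neg, smul_eq_mul] at h1
  unfold besselMellin
  rw [← h1, ← h2]
  congr 1
  ext t
  rcases eq_or_ne t 0 with rfl | ht
  · simp
  · congr 3
    field_simp
    ring

lemma norm_cpow_mul_exp_eq {t : ℝ} (ht : 0 < t) (ν : ℂ) (r : ℝ) :
    ‖(t : ℂ) ^ ν * ((Real.exp r : ℝ) : ℂ)‖ = t ^ ν.re * Real.exp r := by
  rw [norm_mul, norm_cpow_eq_rpow_re_of_pos ht, Complex.norm_real, Real.norm_eq_abs, Real.abs_exp]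

lemma hasDerivAt_besselMellin {y : ℝ} (hy : 0 < y) (ν : ℂ) :
    HasDerivAt (besselMellin ν) (-besselMellin (ν - 1) y) y := by
  have hm : ∀ (y : ℝ) (s : ℂ), AEStronglyMeasurable
      (fun t : ℝ => (t : ℂ) ^ (s - 1) • ((Real.exp (-(t + y / t)) : ℝ) : ℂ))
      (volume.restrict (Ioi 0)) := by
    intro y s
    apply Measurable.aestronglyMeasurable
    fun_prop
  -- The differentiated integrand is dominated near y by its value at y/2, since e^(-z/t) decreases
  -- in z.
  have h := hasDerivAt_integral_of_dominated_loc_of_deriv_le (𝕜 := ℝ)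
    (μ := volume.restrict (Ioi (0 : ℝ)))
    (F := fun (y : ℝ) (t : ℝ) => (t : ℂ) ^ (ν - 1) • ((Real.exp (-(t + y / t)) : ℝ) : ℂ))
    (F' := fun (y : ℝ) (t : ℝ) => -((t : ℂ) ^ (ν - 1 - 1) • ((Real.exp (-(t + y / t)) : ℝ) : ℂ)))
    (x₀ := y) (s := Ioi (y / 2))
    (bound := fun t => ‖(t : ℂ) ^ (ν - 1 - 1) • ((Real.exp (-(t + y / 2 / t)) : ℝ) : ℂ)‖)
    (Ioi_mem_nhds (by linarith)) (Eventually.of_forall fun y => hm y ν)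
    (mellinConvergent_exp_neg_add_div hy ν) (hm y (ν - 1)).neg ?_
    (mellinConvergent_exp_neg_add_div (half_pos hy) (ν - 1)).norm ?_
  · have h2 := h.2
    rw [integral_neg] at h2
    exact h2
  · filter_upwards [ae_restrict_mem measurableSet_Ioi] with t ht z hz
    have ht' : 0 < t := ht
    have hz' : y / 2 < z := hz
    simp only [smul_eq_mul]
    rw [norm_neg, norm_cpow_mul_exp_eq ht', norm_cpow_mul_exp_eq ht']
    gcongr
  · filter_upwards [ae_restrict_mem measurableSet_Ioi] with t ht z hz
    have ht' : 0 < t := ht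
    have ht0 : (t : ℂ) ≠ 0 := by exact_mod_cast ht'.ne'
    have h1 : HasDerivAt (fun z : ℝ => Real.exp (-(t + z / t)))
        (Real.exp (-(t + z / t)) * (-(1 / t))) z := by
      have := (((hasDerivAt_id z).div_const t).const_add t).neg.exp
      simpa using this
    have h2 := (h1.ofReal_comp).const_mul ((t : ℂ) ^ (ν - 1))
    refine h2.congr_deriv ?_
    rw [smul_eq_mul, cpow_sub (ν - 1) 1 ht0, cpow_one]
    push_cast
    ring

lemma tendsto_besselMellin_zero {ν : ℂ} (hν : 0 < ν.re) :
    Tendsto (besselMellin ν) (𝓝[>] 0) (𝓝 (Gamma ν)) := by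
  have hG : Gamma ν = ∫ t in Ioi (0 : ℝ), (t : ℂ) ^ (ν - 1) • ((Real.exp (-t) : ℝ) : ℂ) := by
    rw [Gamma_eq_integral hν, GammaIntegral_eq_mellin]
    rfl
  have hint := GammaIntegral_convergent hν
  rw [hG]
  refine tendsto_integral_filter_of_dominated_convergence
    (fun t : ℝ => ‖((Real.exp (-t) : ℝ) : ℂ) * (t : ℂ) ^ (ν - 1)‖) ?_ ?_ ?_ ?_
  · refine Eventually.of_forall fun y => ?_
    apply Measurable.aestronglyMeasurable
    fun_prop
  · filter_upwards [self_mem_nhdsWithin] with y hy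
    have hy' : 0 < y := hy
    filter_upwards [ae_restrict_mem measurableSet_Ioi] with t ht
    have ht' : 0 < t := ht
    rw [mul_comm, smul_eq_mul, norm_cpow_mul_exp_eq ht', norm_cpow_mul_exp_eq ht']
    gcongr
    have : 0 < y / t := by positivity
    linarith
  · simpa using! hint.norm
  · filter_upwards [ae_restrict_mem measurableSet_Ioi] with t ht
    have ht' : t ≠ 0 := (mem_Ioi.1 ht).ne'
    have : Continuous fun y : ℝ => (t : ℂ) ^ (ν - 1) • ((Real.exp (-(t + y / t)) : ℝ) : ℂ) := by
      fun_prop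
    have h := this.tendsto 0
    simp only [zero_div, add_zero] at h
    exact h.mono_left nhdsWithin_le_nhds

lemma eq_of_hasDerivAt_zero_of_tendsto {f : ℝ → ℂ} {L : ℂ}
    (hf : ∀ y, 0 < y → HasDerivAt f 0 y) (hL : Tendsto f (𝓝[>] 0) (𝓝 L)) {y : ℝ} (hy : 0 < y) :
    f y = L := by
  have hc : ∀ z, 0 < z → f z = f y := fun z hz =>
    isOpen_Ioi.is_const_of_deriv_eq_zero isPreconnected_Ioi
      (fun w hw => (hf w hw).differentiableAt.differentiableWithinAt)
      (fun w hw => (hf w hw).deriv) hz hy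
  refine tendsto_nhds_unique (tendsto_const_nhds.congr' ?_) hL
  filter_upwards [self_mem_nhdsWithin] with z hz using (hc z hz).symm

lemma hasDerivAt_ofReal_cpow_const_sub {y : ℝ} (hy : 0 < y) (r : ℂ) :
    HasDerivAt (fun y : ℝ => (y : ℂ) ^ r) (r * (y : ℂ) ^ (r - 1)) y := by
  rcases eq_or_ne r 0 with rfl | hr
  · simpa using hasDerivAt_const y (1 : ℂ)
  · exact hasDerivAt_ofReal_cpow_const hy.ne' hr

lemma hasDerivAt_besselR_ofReal (μ : ℂ) (y : ℝ) :
    HasDerivAt (fun y : ℝ => besselR μ y) (besselR (μ + 1) y) y :=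
  (hasDerivAt_besselR μ y).comp_ofReal

lemma hasDerivAt_cpow_mul_besselR {y : ℝ} (hy : 0 < y) (μ : ℂ) :
    HasDerivAt (fun y : ℝ => (y : ℂ) ^ μ * besselR μ y)
      ((y : ℂ) ^ (μ - 1) * besselR (μ - 1) y) y := by
  refine ((hasDerivAt_ofReal_cpow_const_sub hy μ).mul (hasDerivAt_besselR_ofReal μ y)).congr_deriv ?_
  have hy0 : (y : ℂ) ≠ 0 := by exact_mod_cast hy.ne'
  rw [← besselR_recurrence, cpow_sub _ _ hy0, cpow_one]
  field_simp
  ring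

lemma tendsto_besselR_zero (μ : ℂ) :
    Tendsto (fun y : ℝ => besselR μ y) (𝓝[>] 0) (𝓝 (Gamma (μ + 1))⁻¹) := by
  have h := (hasDerivAt_besselR_ofReal μ 0).continuousAt.tendsto
  simp only [ofReal_zero, besselR_zero] at h
  exact h.mono_left nhdsWithin_le_nhds

lemma tendsto_cpow_zero {μ : ℂ} (hμ : 0 < μ.re) :
    Tendsto (fun y : ℝ => (y : ℂ) ^ μ) (𝓝[>] 0) (𝓝 0) := by
  have h := (continuousAt_ofReal_cpow_const 0 μ (Or.inl hμ)).tendsto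
  have hμ0 : μ ≠ 0 := by
    rintro rfl
    simp at hμ
  simp only [ofReal_zero, zero_cpow hμ0] at h
  exact h.mono_left nhdsWithin_le_nhds

lemma hasDerivAt_besselMellin' {y : ℝ} (hy : 0 < y) (ν : ℂ) :
    HasDerivAt (besselMellin ν) (-((y : ℂ) ^ (ν - 1) * besselMellin (1 - ν) y)) y := by
  refine (hasDerivAt_besselMellin hy ν).congr_deriv ?_
  rw [besselMellin_eq_cpow_mul hy, neg_sub]

/-! ### Wronskian relations and identification of the integral with K_ν -/

lemma besselMellin_wronskian {ν : ℂ} (h0 : 0 < ν.re) (h1 : ν.re < 1) {y : ℝ} (hy : 0 < y) :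
    besselMellin ν y * ((y : ℂ) ^ (1 - ν) * besselR (1 - ν) y)
      + besselMellin (1 - ν) y * besselR (-ν) y = 1 := by
  have h1' : 0 < (1 - ν).re := by simpa using h1
  refine eq_of_hasDerivAt_zero_of_tendsto (f := fun y : ℝ =>
    besselMellin ν y * ((y : ℂ) ^ (1 - ν) * besselR (1 - ν) y)
      + besselMellin (1 - ν) y * besselR (-ν) y) (fun y hy => ?_) ?_ hy
  · refine (((hasDerivAt_besselMellin' hy ν).mul (hasDerivAt_cpow_mul_besselR hy (1 - ν))).add
      ((hasDerivAt_besselMellin' hy (1 - ν)).mul (hasDerivAt_besselR_ofReal (-ν) y))).congr_deriv ?_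
    have hy0 : (y : ℂ) ≠ 0 := by exact_mod_cast hy.ne'
    have hp : (y : ℂ) ^ (ν - 1) * (y : ℂ) ^ (1 - ν) = 1 := by
      rw [← cpow_add _ _ hy0]; simp
    rw [show 1 - (1 - ν) = ν by ring, show 1 - ν - 1 = -ν by ring, show -ν + 1 = 1 - ν by ring]
    linear_combination -(besselMellin (1 - ν) y * besselR (1 - ν) y) * hp
  · have h := ((tendsto_besselMellin_zero h0).mul ((tendsto_cpow_zero h1').mul
      (tendsto_besselR_zero (1 - ν)))).add ((tendsto_besselMellin_zero h1').mul
      (tendsto_besselR_zero (-ν)))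
    have hG := Gamma_ne_zero_of_re_pos h1'
    rwa [zero_mul, mul_zero, zero_add, show -ν + 1 = 1 - ν by ring, mul_inv_cancel₀ hG] at h

/-- The derivative vanishes by the recurrence at ν and 1 - ν, and the value at y → 0 is
1/(Γ(ν)Γ(1-ν)), given by the reflection formula. -/
lemma besselR_wronskian {ν : ℂ} (h1 : ν.re < 1) {y : ℝ} (hy : 0 < y) :
    besselR (-ν) y * besselR (ν - 1) y - y * (besselR (1 - ν) y * besselR ν y)
      = Complex.sin (Real.pi * ν) / Real.pi := by
  have h1' : 0 < (1 - ν).re := by simpa using h1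
  refine eq_of_hasDerivAt_zero_of_tendsto (f := fun y : ℝ =>
    besselR (-ν) y * besselR (ν - 1) y - y * (besselR (1 - ν) y * besselR ν y))
    (fun y hy => ?_) ?_ hy
  · refine (((hasDerivAt_besselR_ofReal (-ν) y).mul (hasDerivAt_besselR_ofReal (ν - 1) y)).sub
      ((hasDerivAt_id y).ofReal_comp.mul ((hasDerivAt_besselR_ofReal (1 - ν) y).mul
      (hasDerivAt_besselR_ofReal ν y)))).congr_deriv ?_
    have e1 := besselR_recurrence ν y
    have e2 := besselR_recurrence (1 - ν) y
    rw [show 1 - ν - 1 = -ν by ring] at e2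
    simp only [Pi.mul_apply, ofReal_one, id, sub_add_cancel, show -ν + 1 = 1 - ν by ring]
    linear_combination -besselR (1 - ν) y * e1 - besselR ν y * e2
  · have hid : Tendsto (fun y : ℝ => (y : ℂ)) (𝓝[>] 0) (𝓝 0) := by
      have := continuous_ofReal.tendsto 0
      rw [ofReal_zero] at this
      exact this.mono_left nhdsWithin_le_nhds
    have h := ((tendsto_besselR_zero (-ν)).mul (tendsto_besselR_zero (ν - 1))).sub
      (hid.mul ((tendsto_besselR_zero (1 - ν)).mul (tendsto_besselR_zero ν)))
    have hG := Gamma_mul_Gamma_one_sub ν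
    rwa [zero_mul, sub_zero, ← mul_inv, show -ν + 1 = 1 - ν by ring, sub_add_cancel, mul_comm (Gamma _),
      hG, inv_div] at h

/-- The mixed Wronskian at ν and at 1 - ν gives two linear equations for M_ν and M_{1-ν}.
Eliminating M_{1-ν} leaves M_ν times the determinant computed in `besselR_wronskian`. In the strip
both integrals have finite limits at y → 0, which is what fixes the constants. -/
lemma besselMellin_eq_of_re_lt_one {ν : ℂ} (h0 : 0 < ν.re) (h1 : ν.re < 1) {y : ℝ} (hy : 0 < y) :
    Complex.sin (Real.pi * ν) * besselMellin ν y
      = Real.pi * (besselR (-ν) y - (y : ℂ) ^ ν * besselR ν y) := by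
  have h1' : 0 < (1 - ν).re := by simpa using h1
  have e1 := besselMellin_wronskian h0 h1 hy
  have e2 := besselMellin_wronskian (ν := 1 - ν) h1' (by simpa using h0) hy
  have e3 := besselR_wronskian h1 hy
  have hy0 : (y : ℂ) ≠ 0 := by exact_mod_cast hy.ne'
  have hπ : (Real.pi : ℂ) ≠ 0 := by exact_mod_cast Real.pi_ne_zero
  have hp : (y : ℂ) ^ ν * (y : ℂ) ^ (1 - ν) = y := by
    rw [← cpow_add _ _ hy0]; simp
  rw [sub_sub_cancel, neg_sub] at e2
  rw [eq_div_iff hπ] at e3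
  rw [← e3]
  linear_combination Real.pi * besselR (-ν) y * e2 - Real.pi * (y : ℂ) ^ ν * besselR ν y * e1
    + Real.pi * besselMellin ν y * besselR ν y * besselR (1 - ν) y * hp

/-- Both sides are entire in ν, so the identity on the strip 0 < Re ν < 1 extends to all orders. -/
lemma besselMellin_eq {y : ℝ} (hy : 0 < y) (ν : ℂ) :
    Complex.sin (Real.pi * ν) * besselMellin ν y
      = Real.pi * (besselR (-ν) y - (y : ℂ) ^ ν * besselR ν y) := by
  have hy0 : (y : ℂ) ≠ 0 := by exact_mod_cast hy.ne'
  have hd1 : Differentiable ℂ fun ν : ℂ => Complex.sin (Real.pi * ν) * besselMellin ν y :=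
    (differentiable_sin.comp (differentiable_id.const_mul _)).mul (differentiable_besselMellin hy)
  have hd2 : Differentiable ℂ fun ν : ℂ =>
      Real.pi * (besselR (-ν) y - (y : ℂ) ^ ν * besselR ν y) :=
    ((((differentiable_besselR_order y).comp differentiable_neg)).sub
      ((differentiable_id.const_cpow (Or.inl hy0)).mul
        (differentiable_besselR_order y))).const_mul _
  have h := AnalyticOnNhd.eq_of_eventuallyEq (z₀ := (1 / 2 : ℂ))
    (hd1.differentiableOn.analyticOnNhd isOpen_univ)
    (hd2.differentiableOn.analyticOnNhd isOpen_univ) ?_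
  · exact congrFun h ν
  · have ho : IsOpen {ν : ℂ | 0 < ν.re ∧ ν.re < 1} :=
      (isOpen_lt continuous_const continuous_re).inter (isOpen_lt continuous_re continuous_const)
    filter_upwards [ho.mem_nhds (show (1 / 2 : ℂ) ∈ _ by norm_num)] with μ hμ
    exact besselMellin_eq_of_re_lt_one hμ.1 hμ.2 hy

lemma sin_pi_mul_eq_zero_iff (ν : ℂ) : Complex.sin (Real.pi * ν) = 0 ↔ ∃ j : ℤ, ν = j := by
  have hπ : (Real.pi : ℂ) ≠ 0 := by exact_mod_cast Real.pi_ne_zero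
  rw [Complex.sin_eq_zero_iff]
  refine exists_congr fun j => ?_
  rw [mul_comm (j : ℂ), mul_right_inj' hπ]

lemma besselI_eq {z : ℝ} (hz : 0 < z) (ν : ℂ) :
    besselI ν z = ((z / 2 : ℝ) : ℂ) ^ ν * besselR ν ((z ^ 2 / 4 : ℝ) : ℂ) := by
  have hz2 : ((z / 2 : ℝ) : ℂ) ≠ 0 := by
    have : z / 2 ≠ 0 := by positivity
    exact_mod_cast this
  unfold besselI besselR
  rw [← tsum_mul_left]
  refine tsum_congr fun n => ?_
  rw [show ((z : ℂ) / 2) = ((z / 2 : ℝ) : ℂ) by push_cast; ring, cpow_add _ _ hz2, mul_div_assoc]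
  congr 2
  rw [show 2 * (n : ℂ) = ((2 * n : ℕ) : ℂ) by push_cast; ring, cpow_natCast, pow_mul]
  congr 1
  push_cast
  ring

lemma besselKQuot_eq {z : ℝ} (hz : 0 < z) {ν : ℂ} (hν : ¬ ∃ j : ℤ, ν = j) :
    besselKQuot ν z
      = 1 / 2 * ((z / 2 : ℝ) : ℂ) ^ (-ν) * besselMellin ν (z ^ 2 / 4) := by
  have hs : Complex.sin (Real.pi * ν) ≠ 0 := fun h => hν ((sin_pi_mul_eq_zero_iff ν).1 h)
  have hz2 : ((z / 2 : ℝ) : ℂ) ≠ 0 := by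
    have : z / 2 ≠ 0 := by positivity
    exact_mod_cast this
  have h := besselMellin_eq (y := z ^ 2 / 4) (by positivity) ν
  have hp : (((z ^ 2 / 4 : ℝ) : ℂ)) ^ ν = ((z / 2 : ℝ) : ℂ) ^ ν * ((z / 2 : ℝ) : ℂ) ^ ν := by
    rw [← mul_cpow_ofReal_nonneg (by positivity) (by positivity), ← ofReal_mul]
    congr 2
    ring
  have hq : ((z / 2 : ℝ) : ℂ) ^ ν * ((z / 2 : ℝ) : ℂ) ^ (-ν) = 1 := by
    rw [← cpow_add _ _ hz2]; simp
  rw [hp] at h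
  unfold besselKQuot
  rw [besselI_eq hz, besselI_eq hz]
  rw [← mul_div_assoc, div_eq_iff hs]
  linear_combination -(1 / 2 * ((z / 2 : ℝ) : ℂ) ^ (-ν)) * h +
    Real.pi / 2 * ((z / 2 : ℝ) : ℂ) ^ ν * besselR ν ((z ^ 2 / 4 : ℝ) : ℂ) * hq

/-- At integer order the definition is a limit; the right side is continuous in the order and agrees
with the quotient on a punctured neighbourhood, so it is that limit. -/
lemma besselK_eq {z : ℝ} (hz : 0 < z) (ν : ℂ) :
    besselK ν z = 1 / 2 * ((z / 2 : ℝ) : ℂ) ^ (-ν) * besselMellin ν (z ^ 2 / 4) := by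
  unfold besselK
  split_ifs with hν
  · have hz2 : ((z / 2 : ℝ) : ℂ) ≠ 0 := by
      have : z / 2 ≠ 0 := by positivity
      exact_mod_cast this
    have hc : Continuous fun μ : ℂ =>
        1 / 2 * ((z / 2 : ℝ) : ℂ) ^ (-μ) * besselMellin μ (z ^ 2 / 4) :=
      (continuous_const.mul (continuous_neg.const_cpow (Or.inl hz2))).mul
        (differentiable_besselMellin (by positivity)).continuous
    refine Tendsto.limUnder_eq (((hc.tendsto ν).mono_left nhdsWithin_le_nhds).congr' ?_)
    have hd : ∀ᶠ μ in 𝓝[≠] ν, Complex.sin (Real.pi * μ) ≠ 0 := by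
      have hd1 : Differentiable ℂ fun μ : ℂ => Complex.sin (Real.pi * μ) :=
        differentiable_sin.comp (differentiable_id.const_mul _)
      have hd2 := hd1.differentiableOn.analyticOnNhd (s := univ) isOpen_univ
      rcases (hd2 ν (mem_univ _)).eventually_eq_zero_or_eventually_ne_zero with h | h
      -- Zeros of an analytic function are isolated unless it vanishes identically, which the value
      -- sin(π/2) = 1 excludes.
      · have h2 := congrFun (hd2.eq_of_eventuallyEq (g := fun _ => 0) analyticOnNhd_const h) (1 / 2)
        rw [show (Real.pi : ℂ) * (1 / 2) = Real.pi / 2 by ring, Complex.sin_pi_div_two] at h2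
        simp at h2
      · exact h
    filter_upwards [hd] with μ hμ
    exact (besselKQuot_eq hz fun h => hμ ((sin_pi_mul_eq_zero_iff μ).2 h)).symm
  · exact besselKQuot_eq hz hν

/-! ### Laplace integrals of u^k e^(-bu) with complex b -/

lemma norm_pow_mul_exp_neg_mul {u : ℝ} (hu : 0 ≤ u) (k : ℕ) (b : ℂ) :
    ‖(u : ℂ) ^ k * exp (-(b * u))‖ = u ^ k * Real.exp (-(b.re * u)) := by
  rw [norm_mul, norm_pow, Complex.norm_real, Real.norm_eq_abs, abs_of_nonneg hu, norm_exp]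
  simp

lemma integrableOn_pow_mul_exp_neg_mul_real {r : ℝ} (hr : 0 < r) (k : ℕ) :
    IntegrableOn (fun u : ℝ => u ^ k * Real.exp (-(r * u))) (Ioi 0) := by
  have h := integrableOn_rpow_mul_exp_neg_mul_rpow (p := 1) (s := k) (b := r)
    (by have : (0 : ℝ) ≤ k := k.cast_nonneg
        linarith) one_pos hr
  refine h.congr_fun (fun u hu => ?_) measurableSet_Ioi
  simp

lemma integrableOn_pow_mul_exp_neg_mul {b : ℂ} (hb : 0 < b.re) (k : ℕ) :
    IntegrableOn (fun u : ℝ => (u : ℂ) ^ k * exp (-(b * u))) (Ioi 0) := by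
  refine Integrable.mono' (integrableOn_pow_mul_exp_neg_mul_real hb k) ?_ ?_
  · apply Continuous.aestronglyMeasurable
    fun_prop
  · filter_upwards [ae_restrict_mem measurableSet_Ioi] with u hu
    exact (norm_pow_mul_exp_neg_mul (mem_Ioi.1 hu).le k b).le

lemma tendsto_pow_mul_exp_neg_mul_atTop {b : ℂ} (hb : 0 < b.re) (k : ℕ) :
    Tendsto (fun u : ℝ => (u : ℂ) ^ k * exp (-(b * u))) atTop (𝓝 0) := by
  rw [tendsto_zero_iff_norm_tendsto_zero]
  have h := tendsto_rpow_mul_exp_neg_mul_atTop_nhds_zero k b.re hb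
  refine h.congr' ?_
  filter_upwards [eventually_ge_atTop 0] with u hu
  rw [norm_pow_mul_exp_neg_mul hu]
  simp

lemma integral_pow_mul_exp_neg_mul {b : ℂ} (hb : 0 < b.re) (k : ℕ) :
    ∫ u in Ioi (0 : ℝ), (u : ℂ) ^ k * exp (-(b * u)) = k.factorial / b ^ (k + 1) := by
  have hb0 : b ≠ 0 := by
    rintro rfl
    simp at hb
  have hexp : ∀ u : ℝ, HasDerivAt (fun u : ℝ => exp (-(b * u))) (-b * exp (-(b * u))) u := by
    intro u
    have := ((hasDerivAt_id u).ofReal_comp.const_mul b).neg.cexp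
    refine this.congr_deriv ?_
    simp [mul_comm]
  induction k with
  | zero =>
    have h := integral_Ioi_of_hasDerivAt_of_tendsto' (a := 0)
      (f := fun u : ℝ => -(exp (-(b * u)) / b)) (f' := fun u : ℝ => (u : ℂ) ^ 0 * exp (-(b * u)))
      (m := 0)
      (fun u _ => (((hexp u).div_const b).neg).congr_deriv (by field_simp))
      (integrableOn_pow_mul_exp_neg_mul hb 0)
      (by simpa using ((tendsto_pow_mul_exp_neg_mul_atTop hb 0).div_const b).neg)
    rw [h]
    simp
  | succ k ih =>
    have hi := (integrableOn_pow_mul_exp_neg_mul hb k).const_mul ((k + 1 : ℂ) / b)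
    have h := integral_Ioi_of_hasDerivAt_of_tendsto' (a := 0)
      (f := fun u : ℝ => -((u : ℂ) ^ (k + 1) * exp (-(b * u)) / b))
      (f' := fun u : ℝ => (u : ℂ) ^ (k + 1) * exp (-(b * u)) -
        (k + 1 : ℂ) / b * ((u : ℂ) ^ k * exp (-(b * u))))
      (m := 0)
      (fun u _ => (((((hasDerivAt_id u).ofReal_comp.pow (k + 1)).mul (hexp u)).div_const
        b).neg).congr_deriv (by
          simp only [id, Nat.add_sub_cancel, ofReal_one, Pi.pow_apply]
          push_cast
          field_simp
          ring))
      ((integrableOn_pow_mul_exp_neg_mul hb (k + 1)).sub hi)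
      (by simpa using ((tendsto_pow_mul_exp_neg_mul_atTop hb (k + 1)).div_const b).neg)
    rw [integral_sub (integrableOn_pow_mul_exp_neg_mul hb (k + 1)) hi, integral_const_mul,
      ih] at h
    simp only [ofReal_zero, mul_zero, neg_zero, exp_zero, mul_one, ne_eq, Nat.add_eq_zero_iff,
      one_ne_zero, and_false, not_false_eq_true, zero_pow, zero_div, sub_zero, sub_eq_zero] at h
    rw [h, Nat.factorial_succ]
    push_cast
    field_simp
    ring

/-! ### The odd kernel: bounds, continuity, geometric expansion -/

/-- The function `u^k sinh (c u (1/2 - θ)) / sinh (c u / 2)`, extended by its limit at zero. -/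
def sineKernel (k : ℕ) (c θ u : ℝ) : ℝ :=
  u ^ k * ((Real.exp (-(c * |u| * θ)) - Real.exp (-(c * |u| * (1 - θ))))
    / (1 - Real.exp (-(c * |u|))))

lemma sineKernel_neg {k : ℕ} (hk : Odd k) (c θ u : ℝ) :
    sineKernel k c θ (-u) = -sineKernel k c θ u := by
  unfold sineKernel
  rw [abs_neg, hk.neg_pow, neg_mul]

section

variable {k : ℕ} {c θ : ℝ}

lemma one_sub_exp_neg_pos (hc : 0 < c) {u : ℝ} (hu : u ≠ 0) : 0 < 1 - Real.exp (-(c * |u|)) := by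
  have : 0 < c * |u| := mul_pos hc (abs_pos.2 hu)
  have : Real.exp (-(c * |u|)) < 1 := Real.exp_lt_one_iff.2 (by linarith)
  linarith

/-- Both exponentials in the numerator lie between e^(-c|u|) and 1, so their difference is at most
the denominator in absolute value. -/
lemma abs_sineKernel_le (hc : 0 < c) (h0 : 0 < θ) (h1 : θ < 1) (u : ℝ) :
    |sineKernel k c θ u| ≤ |u| ^ k := by
  unfold sineKernel
  rw [abs_mul, abs_pow]
  refine mul_le_of_le_one_right (by positivity) ?_
  rcases eq_or_ne u 0 with rfl | hu
  · simp
  have hp := one_sub_exp_neg_pos hc hu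
  have ha : 0 < c * |u| := mul_pos hc (abs_pos.2 hu)
  rw [abs_div, abs_of_pos hp, div_le_one hp, abs_le]
  have e1 : Real.exp (-(c * |u| * θ)) ≤ 1 := Real.exp_le_one_iff.2 (by nlinarith)
  have e2 : Real.exp (-(c * |u| * (1 - θ))) ≤ 1 := Real.exp_le_one_iff.2 (by nlinarith)
  have e3 : Real.exp (-(c * |u|)) ≤ Real.exp (-(c * |u| * θ)) := Real.exp_le_exp.2 (by nlinarith)
  have e4 : Real.exp (-(c * |u|)) ≤ Real.exp (-(c * |u| * (1 - θ))) :=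
    Real.exp_le_exp.2 (by nlinarith)
  constructor <;> linarith

lemma continuous_sineKernel (hk : k ≠ 0) (hc : 0 < c) (h0 : 0 < θ) (h1 : θ < 1) :
    Continuous (sineKernel k c θ) := by
  rw [continuous_iff_continuousAt]
  intro u
  rcases eq_or_ne u 0 with rfl | hu
  · have hz : sineKernel k c θ 0 = 0 := by simp [sineKernel]
    unfold ContinuousAt
    rw [hz]
    refine squeeze_zero_norm (a := fun u : ℝ => |u| ^ k)
      (fun u => abs_sineKernel_le hc h0 h1 u) ?_
    have : Continuous fun u : ℝ => |u| ^ k := by fun_prop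
    simpa [hk] using this.tendsto 0
  · have hp := (one_sub_exp_neg_pos hc hu).ne'
    unfold sineKernel
    fun_prop (disch := assumption)

lemma pow_mul_exp_neg_le {a x : ℝ} (ha : 0 < a) (hx : 0 ≤ x) (n : ℕ) :
    x ^ n * Real.exp (-(a * x)) ≤ n.factorial / a ^ n := by
  have h := Real.pow_div_factorial_le_exp (a * x) (by positivity) n
  rw [div_le_iff₀ (by positivity), mul_pow] at h
  rw [Real.exp_neg, le_div_iff₀ (by positivity), ← div_eq_mul_inv, div_mul_eq_mul_div,
    div_le_iff₀ (Real.exp_pos _)]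
  linarith

/-- Quadratic decay is all that is needed later: it gives integrability, convergence of the integer
translates, and the decay hypothesis of Poisson summation. -/
lemma exists_abs_sineKernel_le (hc : 0 < c) (h0 : 0 < θ) (h1 : θ < 1) :
    ∃ C : ℝ, 0 ≤ C ∧ ∀ u, |sineKernel k c θ u| ≤ C * (1 + u ^ 2)⁻¹ := by
  have hθ : 0 < 1 - θ := by linarith
  have hc1 : 0 < 1 - Real.exp (-c) := by simpa using one_sub_exp_neg_pos hc one_ne_zero
  set A := ((k + 2).factorial / (c * θ) ^ (k + 2) +
    (k + 2).factorial / (c * (1 - θ)) ^ (k + 2) : ℝ) with hA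
  have hA0 : 0 ≤ A := by positivity
  -- The 2 serves |u| ≤ 1, where the kernel is at most 1 and 1 + u² ≤ 2. For |u| ≥ 1 the denominator
  -- is at least 1 - e^(-c), and k + 2 powers of |u| are absorbed by the exponentials.
  refine ⟨max 2 (2 * (A / (1 - Real.exp (-c)))), le_max_of_le_left (by norm_num), fun u => ?_⟩
  rw [← div_eq_mul_inv, le_div_iff₀ (by positivity)]
  rcases le_total |u| 1 with hu | hu
  · refine le_max_of_le_left ?_
    have h2 : |sineKernel k c θ u| ≤ 1 :=
      (abs_sineKernel_le hc h0 h1 u).trans (pow_le_one₀ (abs_nonneg u) hu)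
    have h3 : u ^ 2 ≤ 1 := by
      rw [← sq_abs]
      exact pow_le_one₀ (abs_nonneg u) hu
    nlinarith [abs_nonneg (sineKernel k c θ u)]
  · refine le_max_of_le_right ?_
    have hu0 : u ≠ 0 := by
      rintro rfl
      norm_num at hu
    have hp := one_sub_exp_neg_pos hc hu0
    have e1 := pow_mul_exp_neg_le (mul_pos hc h0) (abs_nonneg u) (k + 2)
    have e2 := pow_mul_exp_neg_le (mul_pos hc hθ) (abs_nonneg u) (k + 2)
    rw [show c * θ * |u| = c * |u| * θ by ring] at e1
    rw [show c * (1 - θ) * |u| = c * |u| * (1 - θ) by ring] at e2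
    have e3 : 1 - Real.exp (-c) ≤ 1 - Real.exp (-(c * |u|)) := by
      have : Real.exp (-(c * |u|)) ≤ Real.exp (-c) := Real.exp_le_exp.2 (by nlinarith)
      linarith
    have e4 : 1 + u ^ 2 ≤ 2 * |u| ^ 2 := by
      rw [← sq_abs u]
      nlinarith
    have e5 : |Real.exp (-(c * |u| * θ)) - Real.exp (-(c * |u| * (1 - θ)))|
        ≤ Real.exp (-(c * |u| * θ)) + Real.exp (-(c * |u| * (1 - θ))) := by
      refine (abs_sub _ _).trans_eq ?_
      rw [abs_of_pos (Real.exp_pos _), abs_of_pos (Real.exp_pos _)]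
    unfold sineKernel
    rw [abs_mul, abs_pow, abs_div, abs_of_pos hp]
    calc _ ≤ |u| ^ k * ((Real.exp (-(c * |u| * θ)) + Real.exp (-(c * |u| * (1 - θ)))) /
          (1 - Real.exp (-c))) * (2 * |u| ^ 2) := by gcongr
      _ = 2 * ((|u| ^ (k + 2) * Real.exp (-(c * |u| * θ)) +
          |u| ^ (k + 2) * Real.exp (-(c * |u| * (1 - θ)))) / (1 - Real.exp (-c))) := by ring
      _ ≤ _ := by
          gcongr
          exact add_le_add e1 e2

lemma hasSum_sineKernel (hc : 0 < c) {u : ℝ} (hu : 0 < u) :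
    HasSum (fun m : ℕ => u ^ k * Real.exp (-(c * u * (m + θ))) -
      u ^ k * Real.exp (-(c * u * (m + 1 - θ)))) (sineKernel k c θ u) := by
  have hlt : Real.exp (-(c * u)) < 1 := Real.exp_lt_one_iff.2 (by nlinarith)
  have h := (hasSum_geometric_of_lt_one (Real.exp_pos _).le hlt).mul_left
    (u ^ k * (Real.exp (-(c * u * θ)) - Real.exp (-(c * u * (1 - θ)))))
  unfold sineKernel
  rw [abs_of_pos hu, ← mul_div_assoc, div_eq_mul_inv]
  refine h.congr_fun fun m => ?_
  have e1 : Real.exp (-(c * u * (m + θ))) = Real.exp (-(c * u * θ)) * Real.exp (-(c * u)) ^ m := by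
    rw [← Real.exp_nat_mul, ← Real.exp_add]
    congr 1
    ring
  have e2 : Real.exp (-(c * u * (m + 1 - θ)))
      = Real.exp (-(c * u * (1 - θ))) * Real.exp (-(c * u)) ^ m := by
    rw [← Real.exp_nat_mul, ← Real.exp_add]
    congr 1
    ring
  rw [e1, e2]
  ring

end

/-! ### The Fourier transform of the kernel -/

section

variable {k : ℕ} {c θ : ℝ}

lemma integrable_sineKernel (hk : k ≠ 0) (hc : 0 < c) (h0 : 0 < θ) (h1 : θ < 1) :
    Integrable fun u => (sineKernel k c θ u : ℂ) := by
  obtain ⟨C, -, hC⟩ := exists_abs_sineKernel_le (k := k) hc h0 h1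
  refine Integrable.mono' (integrable_inv_one_add_sq.const_mul C)
    (continuous_ofReal.comp (continuous_sineKernel hk hc h0 h1)).aestronglyMeasurable
    (Eventually.of_forall fun u => ?_)
  rw [Complex.norm_real]
  exact hC u

lemma fourier_sineKernel_neg (hk : Odd k) (ξ : ℝ) :
    𝓕 (fun u => (sineKernel k c θ u : ℂ)) (-ξ) = -𝓕 (fun u => (sineKernel k c θ u : ℂ)) ξ := by
  rw [Real.fourier_real_eq_integral_exp_smul, Real.fourier_real_eq_integral_exp_smul,
    ← integral_neg, ← integral_neg_eq_self]
  congr 1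
  ext u
  rw [sineKernel_neg hk]
  simp only [ofReal_neg, smul_neg]
  congr 4
  push_cast
  ring

/-- The frequencies occurring in the Laplace expansion of the Fourier integral. -/
def laplaceFreq (c θ ξ : ℝ) (m : ℕ) : ℂ := (c * (m + θ) : ℝ) + 2 * Real.pi * I * ξ

lemma laplaceFreq_re (c θ ξ : ℝ) (m : ℕ) : (laplaceFreq c θ ξ m).re = c * (m + θ) := by
  simp [laplaceFreq]

lemma laplaceFreq_re_pos (hc : 0 < c) (h0 : 0 < θ) (ξ : ℝ) (m : ℕ) :
    0 < (laplaceFreq c θ ξ m).re := by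
  rw [laplaceFreq_re]
  positivity

lemma summable_const_div_nat_add_pow (hk : k ≠ 0) (h0 : 0 < θ) (C : ℝ) :
    Summable fun m : ℕ => C / (c * (m + θ)) ^ (k + 1) := by
  have h := (Real.summable_one_div_nat_add_rpow θ (k + 1)).2 (by
    have : (0 : ℝ) < k := by positivity
    linarith)
  refine (h.mul_left (C / c ^ (k + 1))).congr fun m => ?_
  have : (0 : ℝ) < m + θ := by positivity
  rw [abs_of_pos this, mul_pow, ← Nat.cast_succ, Real.rpow_natCast]
  field_simp

lemma integral_norm_pow_mul_exp_neg_mul {b : ℂ} (hb : 0 < b.re) (k : ℕ) :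
    ∫ u in Ioi (0 : ℝ), ‖(u : ℂ) ^ k * exp (-(b * u))‖ = k.factorial / b.re ^ (k + 1) := by
  have h := Real.integral_rpow_mul_exp_neg_mul_Ioi (a := k + 1) (by positivity) hb
  rw [Real.Gamma_nat_eq_factorial, ← Nat.cast_succ, Real.rpow_natCast] at h
  rw [div_eq_mul_one_div, ← one_div_pow, mul_comm, ← h]
  refine setIntegral_congr_fun measurableSet_Ioi fun u hu => ?_
  rw [norm_pow_mul_exp_neg_mul (mem_Ioi.1 hu).le]
  simp

lemma integral_add_add_add {α E : Type*} [MeasurableSpace α] [NormedAddCommGroup E]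
    [NormedSpace ℝ E] {μ : Measure α} {f₁ f₂ f₃ f₄ : α → E} (h₁ : Integrable f₁ μ)
    (h₂ : Integrable f₂ μ) (h₃ : Integrable f₃ μ) (h₄ : Integrable f₄ μ) :
    ∫ x, ((f₁ x + f₂ x) + (f₃ x + f₄ x)) ∂μ
      = ((∫ x, f₁ x ∂μ) + ∫ x, f₂ x ∂μ) + ((∫ x, f₃ x ∂μ) + ∫ x, f₄ x ∂μ) := by
  rw [← integral_add h₁ h₂, ← integral_add h₃ h₄]
  exact integral_add (h₁.add h₂) (h₃.add h₄)

lemma integral_sub_sub_sub {α E : Type*} [MeasurableSpace α] [NormedAddCommGroup E]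
    [NormedSpace ℝ E] {μ : Measure α} {f₁ f₂ f₃ f₄ : α → E} (h₁ : Integrable f₁ μ)
    (h₂ : Integrable f₂ μ) (h₃ : Integrable f₃ μ) (h₄ : Integrable f₄ μ) :
    ∫ x, ((f₁ x - f₂ x) - (f₃ x - f₄ x)) ∂μ
      = ((∫ x, f₁ x ∂μ) - ∫ x, f₂ x ∂μ) - ((∫ x, f₃ x ∂μ) - ∫ x, f₄ x ∂μ) := by
  rw [← integral_sub h₁ h₂, ← integral_sub h₃ h₄]
  exact integral_sub (h₁.sub h₂) (h₃.sub h₄)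

/-- The half-line integrals combine by oddness, the kernel is expanded geometrically, and each
exponential is integrated. The interchange is legitimate because ∑ (m+θ)^(-(k+1)) converges, k being
at least 1. -/
lemma hasSum_fourier_sineKernel (hk : Odd k) (hc : 0 < c) (h0 : 0 < θ) (h1 : θ < 1) (ξ : ℝ) :
    HasSum (fun m : ℕ => (k.factorial / laplaceFreq c θ ξ m ^ (k + 1) -
        k.factorial / laplaceFreq c θ (-ξ) m ^ (k + 1)) -
        (k.factorial / laplaceFreq c (1 - θ) ξ m ^ (k + 1) -
        k.factorial / laplaceFreq c (1 - θ) (-ξ) m ^ (k + 1)))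
      (𝓕 (fun u => (sineKernel k c θ u : ℂ)) ξ) := by
  have hk0 : k ≠ 0 := hk.pos.ne'
  have h1' : 0 < 1 - θ := by linarith
  have hb0 := fun ξ m => laplaceFreq_re_pos (θ := θ) hc h0 ξ m
  have hb1 := fun ξ m => laplaceFreq_re_pos (θ := 1 - θ) hc h1' ξ m
  set E : ℂ → ℝ → ℂ := fun b u => (u : ℂ) ^ k * exp (-(b * u)) with hE
  have hEi : ∀ {b : ℂ}, 0 < b.re → IntegrableOn (E b) (Ioi 0) :=
    fun hb => integrableOn_pow_mul_exp_neg_mul hb k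
  set F : ℕ → ℝ → ℂ := fun m u => (E (laplaceFreq c θ ξ m) u - E (laplaceFreq c θ (-ξ) m) u) -
    (E (laplaceFreq c (1 - θ) ξ m) u - E (laplaceFreq c (1 - θ) (-ξ) m) u) with hF
  have hFi : ∀ m, IntegrableOn (F m) (Ioi 0) := fun m =>
    ((hEi (hb0 ξ m)).sub (hEi (hb0 (-ξ) m))).sub ((hEi (hb1 ξ m)).sub (hEi (hb1 (-ξ) m)))
  have hFn : Summable fun m => ∫ u in Ioi (0 : ℝ), ‖F m u‖ := by
    have s0 := summable_const_div_nat_add_pow (c := c) hk0 h0 k.factorial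
    have s1 := summable_const_div_nat_add_pow (c := c) hk0 h1' k.factorial
    refine Summable.of_nonneg_of_le (fun m => integral_nonneg fun u => norm_nonneg _) (fun m => ?_)
      ((s0.add s0).add (s1.add s1))
    have i0 := (hEi (hb0 ξ m)).norm
    have i1 := (hEi (hb0 (-ξ) m)).norm
    have i2 := (hEi (hb1 ξ m)).norm
    have i3 := (hEi (hb1 (-ξ) m)).norm
    have e : ∀ {b : ℂ}, 0 < b.re →
        ∫ u in Ioi (0 : ℝ), ‖E b u‖ = k.factorial / b.re ^ (k + 1) :=
      fun hb => integral_norm_pow_mul_exp_neg_mul hb k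
    calc _ ≤ ∫ u in Ioi (0 : ℝ), ((‖E (laplaceFreq c θ ξ m) u‖ +
          ‖E (laplaceFreq c θ (-ξ) m) u‖) + (‖E (laplaceFreq c (1 - θ) ξ m) u‖ +
          ‖E (laplaceFreq c (1 - θ) (-ξ) m) u‖)) := by
          refine integral_mono (hFi m).norm ((i0.add i1).add (i2.add i3)) fun u => ?_
          exact (norm_sub_le _ _).trans (add_le_add (norm_sub_le _ _) (norm_sub_le _ _))
      _ = _ := by
          rw [integral_add_add_add i0 i1 i2 i3, e (hb0 _ _), e (hb0 _ _), e (hb1 _ _), e (hb1 _ _)]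
          simp only [laplaceFreq_re]
  have h := hasSum_integral_of_summable_integral_norm hFi hFn
  have e : ∀ {b : ℂ}, 0 < b.re →
      ∫ u in Ioi (0 : ℝ), E b u = k.factorial / b ^ (k + 1) :=
    fun hb => integral_pow_mul_exp_neg_mul hb k
  have hval : ∫ u in Ioi (0 : ℝ), ∑' m, F m u = 𝓕 (fun u => (sineKernel k c θ u : ℂ)) ξ := by
    have hg := integrable_sineKernel hk0 hc h0 h1
    have hi : Integrable fun u : ℝ => exp ((-2 * Real.pi * u * ξ : ℝ) * I) •
        (sineKernel k c θ u : ℂ) := by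
      refine hg.bdd_mul (c := 1) ?_ ?_
      · apply Continuous.aestronglyMeasurable
        fun_prop
      · refine Eventually.of_forall fun u => ?_
        rw [norm_exp_ofReal_mul_I]
    rw [Real.fourier_real_eq_integral_exp_smul,
      ← intervalIntegral.integral_Iic_add_Ioi (b := 0) hi.integrableOn hi.integrableOn]
    rw [show Iic (0 : ℝ) = Iic (-0) by simp, ← integral_comp_neg_Ioi,
      ← integral_add hi.comp_neg.integrableOn hi.integrableOn]
    refine setIntegral_congr_fun measurableSet_Ioi fun u hu => ?_
    have hs := Complex.hasSum_ofReal.2 (hasSum_sineKernel (k := k) (θ := θ) hc (mem_Ioi.1 hu))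
    have hs2 := hs.mul_left (exp (-(2 * Real.pi * I * ξ * u)) - exp (2 * Real.pi * I * ξ * u))
    refine (HasSum.tsum_eq (f := fun m => F m u) (hs2.congr_fun fun m => ?_)).trans ?_
    · simp only [hF, hE, laplaceFreq]
      push_cast
      have e1 : ∀ p q : ℂ, exp (-((p + q) * u)) = exp (-(p * u)) * exp (-(q * u)) := by
        intro p q
        rw [← exp_add]
        ring_nf
      have e2 : exp (-(2 * Real.pi * I * -(ξ : ℂ) * u)) = exp (2 * Real.pi * I * ξ * u) := by
        ring_nf
      have e3 : ∀ p : ℂ, exp (-(c * p * u)) = exp (-(c * u * p)) := by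
        intro p
        ring_nf
      simp only [e1, e2, e3, show (m : ℂ) + (1 - θ) = m + 1 - θ by ring]
      ring
    · simp only [smul_eq_mul]
      rw [sineKernel_neg hk]
      push_cast
      rw [show -2 * (Real.pi : ℂ) * -u * ξ * I = 2 * Real.pi * I * ξ * u by ring,
        show -2 * (Real.pi : ℂ) * u * ξ * I = -(2 * Real.pi * I * ξ * u) by ring]
      ring
  rw [hval] at h
  refine h.congr_fun fun m => ?_
  rw [integral_sub_sub_sub (hEi (hb0 _ _)) (hEi (hb0 _ _)) (hEi (hb1 _ _)) (hEi (hb1 _ _)),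
    e (hb0 _ _), e (hb0 _ _), e (hb1 _ _), e (hb1 _ _)]

end

section

variable {k : ℕ} {c θ : ℝ}

/-- The Lipschitz formula, with the integers m and -(m+1) paired. -/
lemma hasSum_inv_int_add_pow (hk : k ≠ 0) (τ : UpperHalfPlane) :
    HasSum (fun m : ℕ => 1 / ((τ : ℂ) + m) ^ (k + 1) + 1 / ((τ : ℂ) - (m + 1)) ^ (k + 1))
      ((-2 * Real.pi * I) ^ (k + 1) / k.factorial *
        ∑' n : ℕ+, (n : ℂ) ^ k * exp (2 * Real.pi * I * τ) ^ (n : ℕ)) := by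
  have hs : Summable fun n : ℤ => 1 / ((τ : ℂ) + n) ^ (k + 1) := by
    have h := EisensteinSeries.linear_right_summable (τ : ℂ) 1 (k := (k + 1 : ℕ)) (by
      have : 1 ≤ k := Nat.one_le_iff_ne_zero.2 hk
      push_cast
      lia)
    refine h.congr fun n => ?_
    rw [zpow_natCast, one_div, Int.cast_one, one_mul]
  have h := hs.hasSum.nat_add_neg_add_one
  rw [EisensteinSeries.qExpansion_identity_pnat (Nat.one_le_iff_ne_zero.2 hk) τ] at h
  refine h.congr_fun fun m => ?_
  push_cast
  ring_nf

lemma summable_pnat_pow_mul_pow (k : ℕ) {q : ℂ} (hq : ‖q‖ < 1) :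
    Summable fun n : ℕ+ => (n : ℂ) ^ k * q ^ (n : ℕ) :=
  (summable_pnat_iff_summable_nat (f := fun n : ℕ => (n : ℂ) ^ k * q ^ n)).2
    (summable_norm_pow_mul_geometric_of_norm_lt_one k hq).of_norm

lemma fourier_sineKernel_eq (hk : Odd k) (hc : 0 < c) (h0 : 0 < θ) (h1 : θ < 1) {ξ : ℝ}
    (hξ : 0 < ξ) :
    𝓕 (fun u => (sineKernel k c θ u : ℂ)) ξ = (-2 * Real.pi * I / c) ^ (k + 1) * (2 * I) *
      ∑' d : ℕ+, ((d : ℝ) ^ k * Real.sin (2 * Real.pi * d * θ) *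
        Real.exp (-(4 * Real.pi ^ 2 / c * ξ * d)) : ℝ) := by
  have hc0 : (c : ℂ) ≠ 0 := by exact_mod_cast hc.ne'
  have hfac : (k.factorial : ℂ) ≠ 0 := by exact_mod_cast k.factorial_ne_zero
  have hσ : 0 < 2 * Real.pi * ξ / c := by positivity
  -- The four families of frequencies are c(τ+m), -c(τ'-(m+1)), c(τ'+m) and -c(τ-(m+1)). Since k + 1
  -- is even the signs disappear, and they assemble into two complete sums over ℤ, at τ and at τ'.
  -- The phases at τ and τ' are conjugate because e^(2πid) = 1, so the difference of the two
  -- q-expansions is a sine series.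
  let τ : UpperHalfPlane := ⟨(θ : ℂ) + (2 * Real.pi * ξ / c : ℝ) * I, by simpa using hσ⟩
  let τ' : UpperHalfPlane := ⟨((1 - θ : ℝ) : ℂ) + (2 * Real.pi * ξ / c : ℝ) * I, by simpa using hσ⟩
  have hτ : (τ : ℂ) = (θ : ℂ) + (2 * Real.pi * ξ / c : ℝ) * I := rfl
  have hτ' : (τ' : ℂ) = ((1 - θ : ℝ) : ℂ) + (2 * Real.pi * ξ / c : ℝ) * I := rfl
  have hZ := ((hasSum_inv_int_add_pow hk.pos.ne' τ).sub
    (hasSum_inv_int_add_pow hk.pos.ne' τ')).mul_left (k.factorial / (c : ℂ) ^ (k + 1))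
  have hke : Even (k + 1) := hk.add_one
  have hkey := (hasSum_fourier_sineKernel hk hc h0 h1 ξ).unique (hZ.congr_fun fun m => ?_)
  · have hq : ∀ d : ℕ, exp (2 * Real.pi * I * τ) ^ d =
        exp (2 * Real.pi * d * θ * I) * exp (-(4 * Real.pi ^ 2 / c * ξ * d)) := by
      intro d
      rw [← exp_nat_mul, ← exp_add, hτ]
      congr 1
      push_cast
      linear_combination (4 * Real.pi ^ 2 / c * ξ * d : ℂ) * I_sq
    have hq' : ∀ d : ℕ, exp (2 * Real.pi * I * τ') ^ d =
        exp (-(2 * Real.pi * d * θ * I)) * exp (-(4 * Real.pi ^ 2 / c * ξ * d)) := by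
      intro d
      rw [← exp_nat_mul, ← exp_add, hτ', ← mul_one (exp (_ + _)), ← exp_nat_mul_two_pi_mul_I d,
        ← exp_add]
      congr 1
      push_cast
      linear_combination (4 * Real.pi ^ 2 / c * ξ * d : ℂ) * I_sq
    rw [hkey, ← mul_sub, ← Summable.tsum_sub
      (summable_pnat_pow_mul_pow k (UpperHalfPlane.norm_exp_two_pi_I_lt_one τ))
      (summable_pnat_pow_mul_pow k (UpperHalfPlane.norm_exp_two_pi_I_lt_one τ')),
      ← mul_assoc, ofReal_tsum, mul_assoc _ (2 * I), ← tsum_mul_left (a := 2 * I), div_pow]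
    congr 1
    · field_simp
    · refine tsum_congr fun d => ?_
      rw [hq, hq']
      push_cast
      rw [Complex.sin, show -(2 * (Real.pi : ℂ) * d * θ) * I = -(2 * Real.pi * d * θ * I) by ring]
      linear_combination ((d : ℂ) ^ k * (exp (2 * Real.pi * d * θ * I) -
        exp (-(2 * Real.pi * d * θ * I))) * exp (-(4 * Real.pi ^ 2 / c * ξ * d))) * I_sq
  · have e1 : laplaceFreq c θ ξ m = c * ((τ : ℂ) + m) := by
      rw [laplaceFreq, hτ]
      push_cast
      field_simp
      ring
    have e2 : laplaceFreq c θ (-ξ) m = -(c * ((τ' : ℂ) - (m + 1))) := by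
      rw [laplaceFreq, hτ']
      push_cast
      field_simp
      ring
    have e3 : laplaceFreq c (1 - θ) ξ m = c * ((τ' : ℂ) + m) := by
      rw [laplaceFreq, hτ']
      push_cast
      field_simp
      ring
    have e4 : laplaceFreq c (1 - θ) (-ξ) m = -(c * ((τ : ℂ) - (m + 1))) := by
      rw [laplaceFreq, hτ]
      push_cast
      field_simp
      ring
    rw [e1, e2, e3, e4, hke.neg_pow, hke.neg_pow]
    simp only [mul_pow, div_eq_mul_inv, mul_inv]
    ring

end

/-! ### Signed sums over shifted lattice points and Poisson summation -/

/-- The signed combination of the values of `T` at the points `(n + ψ, m + θ)`,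
`(n + 1 - ψ, m + θ)`, `(n + ψ, m + 1 - θ)` and `(n + 1 - ψ, m + 1 - θ)`. -/
def signedShift (T : ℝ → ℝ → ℂ) (θ ψ : ℝ) (m n : ℕ) : ℂ :=
  T (n + ψ) (m + θ) - T (n + 1 - ψ) (m + θ) - T (n + ψ) (m + 1 - θ) + T (n + 1 - ψ) (m + 1 - θ)

lemma summable_nat_add_rpow_neg {α p : ℝ} (hα : 0 < α) (hp : 1 < p) :
    Summable fun n : ℕ => ((n : ℝ) + α) ^ (-p) := by
  refine ((Real.summable_one_div_nat_add_rpow α p).2 hp).congr fun n => ?_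
  have : (0 : ℝ) < n + α := by positivity
  rw [abs_of_pos this, Real.rpow_neg this.le, one_div]

lemma summable_rpow_neg_mul_rpow_neg {α β p q : ℝ} (hα : 0 < α) (hβ : 0 < β) (hp : 1 < p)
    (hq : 1 < q) :
    Summable fun i : ℕ × ℕ => ((i.2 : ℝ) + α) ^ (-p) * ((i.1 : ℝ) + β) ^ (-q) := by
  have h := (summable_nat_add_rpow_neg hβ hq).mul_of_nonneg (summable_nat_add_rpow_neg hα hp)
    (fun n => by positivity) (fun n => by positivity)
  exact h.congr fun i => mul_comm _ _

section

variable {θ ψ : ℝ}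

lemma summable_shift {T : ℝ → ℝ → ℂ} {C p q : ℝ} (hp : 1 < p) (hq : 1 < q)
    (hT : ∀ u v, 0 < u → 0 < v → ‖T u v‖ ≤ C * (u ^ (-p) * v ^ (-q))) {α β : ℝ}
    (hα : 0 < α) (hβ : 0 < β) :
    Summable fun i : ℕ × ℕ => ‖T (i.2 + α) (i.1 + β)‖ :=
  Summable.of_nonneg_of_le (fun _ => norm_nonneg _)
    (fun i => hT _ _ (by positivity) (by positivity))
    ((summable_rpow_neg_mul_rpow_neg hα hβ hp hq).mul_left C)

lemma summable_norm_shifts {T : ℝ → ℝ → ℂ} {C p q : ℝ} (hp : 1 < p) (hq : 1 < q)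
    (hT : ∀ u v, 0 < u → 0 < v → ‖T u v‖ ≤ C * (u ^ (-p) * v ^ (-q)))
    (h0 : 0 < θ) (h1 : θ < 1) (h2 : 0 < ψ) (h3 : ψ < 1) :
    Summable fun i : ℕ × ℕ => (‖T (i.2 + ψ) (i.1 + θ)‖ + ‖T (i.2 + 1 - ψ) (i.1 + θ)‖) +
      (‖T (i.2 + ψ) (i.1 + 1 - θ)‖ + ‖T (i.2 + 1 - ψ) (i.1 + 1 - θ)‖) := by
  have h1' : 0 < 1 - θ := by linarith
  have h3' : 0 < 1 - ψ := by linarith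
  have h := ((summable_shift hp hq hT h2 h0).add (summable_shift hp hq hT h3' h0)).add
    ((summable_shift hp hq hT h2 h1').add (summable_shift hp hq hT h3' h1'))
  refine h.congr fun i => ?_
  simp only [← add_sub_assoc]

lemma norm_signedShift_le (T : ℝ → ℝ → ℂ) (θ ψ : ℝ) (m n : ℕ) :
    ‖signedShift T θ ψ m n‖ ≤ (‖T (n + ψ) (m + θ)‖ + ‖T (n + 1 - ψ) (m + θ)‖) +
      (‖T (n + ψ) (m + 1 - θ)‖ + ‖T (n + 1 - ψ) (m + 1 - θ)‖) := by
  have h1 := norm_add_le (T (n + ψ) (m + θ) - T (n + 1 - ψ) (m + θ) - T (n + ψ) (m + 1 - θ))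
    (T (n + 1 - ψ) (m + 1 - θ))
  have h2 := norm_sub_le (T (n + ψ) (m + θ) - T (n + 1 - ψ) (m + θ)) (T (n + ψ) (m + 1 - θ))
  have h3 := norm_sub_le (T (n + ψ) (m + θ)) (T (n + 1 - ψ) (m + θ))
  unfold signedShift
  linarith

lemma summable_signedShift {T : ℝ → ℝ → ℂ} {C p q : ℝ} (hp : 1 < p) (hq : 1 < q)
    (hT : ∀ u v, 0 < u → 0 < v → ‖T u v‖ ≤ C * (u ^ (-p) * v ^ (-q)))
    (h0 : 0 < θ) (h1 : θ < 1) (h2 : 0 < ψ) (h3 : ψ < 1) :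
    Summable fun i : ℕ × ℕ => signedShift T θ ψ i.1 i.2 :=
  Summable.of_norm_bounded (summable_norm_shifts hp hq hT h0 h1 h2 h3)
    fun i => norm_signedShift_le T θ ψ i.1 i.2

end

/-- The exponential counterpart `u^k e^(-cuv)` of `rieszTerm`. -/
def expTerm (k : ℕ) (c u v : ℝ) : ℂ := (u ^ k * Real.exp (-(c * u * v)) : ℝ)

section

variable {k : ℕ} {c θ ψ : ℝ}

/-- Using the decay of order k + 2 in u leaves u^(-2) v^(-(k+2)), whose exponents both exceed 1, so
the double series converges absolutely. -/
lemma norm_expTerm_le (hc : 0 < c) {u v : ℝ} (hu : 0 < u) (hv : 0 < v) :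
    ‖expTerm k c u v‖ ≤
      (k + 2).factorial / c ^ (k + 2) * (u ^ (-2 : ℝ) * v ^ (-((k : ℝ) + 2))) := by
  have h := pow_mul_exp_neg_le (mul_pos hc hv) hu.le (k + 2)
  rw [expTerm, Complex.norm_real, Real.norm_eq_abs, abs_of_nonneg (by positivity)]
  rw [Real.rpow_neg hu.le, Real.rpow_neg hv.le, show (k : ℝ) + 2 = ((k + 2 : ℕ) : ℝ) by push_cast; ring,
    Real.rpow_natCast, Real.rpow_two]
  calc _ = (u ^ (k + 2) * Real.exp (-(c * v * u))) * (u ^ 2)⁻¹ := by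
        rw [show c * v * u = c * u * v by ring, pow_add]
        field_simp
    _ ≤ (k + 2).factorial / (c * v) ^ (k + 2) * (u ^ 2)⁻¹ := by gcongr
    _ = _ := by
        rw [mul_pow]
        field_simp

lemma summable_signedShift_expTerm (hc : 0 < c)
    (h0 : 0 < θ) (h1 : θ < 1) (h2 : 0 < ψ) (h3 : ψ < 1) :
    Summable fun i : ℕ × ℕ => signedShift (expTerm k c) θ ψ i.1 i.2 :=
  summable_signedShift one_lt_two
    (by have : (0 : ℝ) ≤ k := k.cast_nonneg
        linarith)
    (fun _ _ hu hv => norm_expTerm_le hc hu hv) h0 h1 h2 h3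

lemma hasSum_sub_expTerm (hc : 0 < c) {u : ℝ} (hu : 0 < u) :
    HasSum (fun m : ℕ => expTerm k c u (m + θ) - expTerm k c u (m + 1 - θ))
      (sineKernel k c θ u : ℂ) := by
  refine (Complex.hasSum_ofReal.2 (hasSum_sineKernel (k := k) (θ := θ) hc hu)).congr_fun
    fun m => ?_
  rw [expTerm, expTerm, ofReal_sub]

lemma summable_int_sineKernel (hc : 0 < c) (h0 : 0 < θ) (h1 : θ < 1) (h2 : 0 < ψ) (h3 : ψ < 1) :
    Summable fun n : ℤ => (sineKernel k c θ (ψ + n) : ℂ) := by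
  obtain ⟨C, hC0, hC⟩ := exists_abs_sineKernel_le (k := k) hc h0 h1
  refine Summable.of_norm_bounded
    (((Real.summable_one_div_int_add_rpow ψ 2).2 one_lt_two).mul_left C) fun n => ?_
  rw [Complex.norm_real, Real.norm_eq_abs, add_comm]
  refine (hC _).trans (mul_le_mul_of_nonneg_left ?_ hC0)
  -- No translate of ψ by an integer hits the origin, as 0 < ψ < 1.
  have hn : (n : ℝ) + ψ ≠ 0 := by
    intro h
    have e1 : (-1 : ℝ) < n := by linarith
    have e2 : (n : ℝ) < 0 := by linarith
    have e3 : (-1 : ℤ) < n := by exact_mod_cast e1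
    have e4 : n < 0 := by exact_mod_cast e2
    omega
  rw [Real.rpow_two, sq_abs, ← one_div]
  have : 0 < (n + ψ : ℝ) ^ 2 := by positivity
  gcongr
  linarith

/-- Summing over m first gives g(n+ψ) - g(n+1-ψ), and oddness rewrites the second term as
+g(ψ-(n+1)): the two halves of a sum over ℤ. -/
lemma tsum_signedShift_expTerm (hk : Odd k) (hc : 0 < c)
    (h0 : 0 < θ) (h1 : θ < 1) (h2 : 0 < ψ) (h3 : ψ < 1) :
    ∑' i : ℕ × ℕ, signedShift (expTerm k c) θ ψ i.1 i.2
      = ∑' n : ℤ, (sineKernel k c θ (ψ + n) : ℂ) := by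
  have hs := (summable_signedShift_expTerm (k := k) hc h0 h1 h2 h3).hasSum
  rw [← (Equiv.prodComm ℕ ℕ).hasSum_iff] at hs
  have hr := hs.prod_fiberwise (g := fun n : ℕ =>
    ((sineKernel k c θ (n + ψ) : ℂ) - sineKernel k c θ (n + 1 - ψ))) fun n => by
      have a2 : (0 : ℝ) < n + 1 - ψ := by have : (0 : ℝ) ≤ n := n.cast_nonneg
                                          linarith
      refine ((hasSum_sub_expTerm (k := k) (θ := θ) hc (u := n + ψ) (by positivity)).sub
        (hasSum_sub_expTerm (k := k) (θ := θ) hc a2)).congr_fun fun m => ?_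
      simp only [Function.comp_apply, Equiv.prodComm_apply, Prod.swap_prod_mk, signedShift]
      ring
  refine hr.unique ?_
  refine ((summable_int_sineKernel (k := k) hc h0 h1 h2
    h3).hasSum.nat_add_neg_add_one).congr_fun fun n => ?_
  push_cast
  rw [show ψ + -((n : ℝ) + 1) = -(n + 1 - ψ) by ring, sineKernel_neg hk, add_comm ψ]
  push_cast
  ring

/-- The doubly damped sine series. -/
def dampedSine (k : ℕ) (θ ψ s : ℝ) (i : ℕ+ × ℕ+) : ℝ :=
  (i.2 : ℝ) ^ k * Real.sin (2 * Real.pi * i.2 * θ) * Real.sin (2 * Real.pi * i.1 * ψ) *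
    Real.exp (-(s * i.1 * i.2))

lemma summable_pow_mul_exp_prod (k : ℕ) {s : ℝ} (hs : 0 < s) :
    Summable fun i : ℕ+ × ℕ+ => (i.2 : ℝ) ^ k * Real.exp (-(s * i.1 * i.2)) := by
  have h := summable_prod_mul_pow (𝕜 := ℝ) k (r := Real.exp (-s)) (by
    rw [Real.norm_eq_abs, Real.abs_exp]
    exact Real.exp_lt_one_iff.2 (by linarith))
  refine h.congr fun i => ?_
  rw [← Real.exp_nat_mul]
  push_cast
  congr 2
  ring

lemma abs_dampedSine_le (k : ℕ) (θ ψ s : ℝ) (i : ℕ+ × ℕ+) :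
    |dampedSine k θ ψ s i| ≤ (i.2 : ℝ) ^ k * Real.exp (-(s * i.1 * i.2)) := by
  rw [dampedSine, abs_mul, abs_mul, abs_mul, Real.abs_exp, abs_pow, Nat.abs_cast]
  gcongr
  refine mul_le_of_le_one_right (by positivity) (Real.abs_sin_le_one _) |>.trans ?_
  exact mul_le_of_le_one_right (by positivity) (Real.abs_sin_le_one _)

lemma summable_dampedSine (k : ℕ) (θ ψ : ℝ) {s : ℝ} (hs : 0 < s) :
    Summable (dampedSine k θ ψ s) :=
  Summable.of_norm_bounded (summable_pow_mul_exp_prod k hs) fun i => abs_dampedSine_le k θ ψ s i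

lemma fourier_sineKernel_zero (hk : Odd k) : 𝓕 (fun u => (sineKernel k c θ u : ℂ)) 0 = 0 := by
  have h := fourier_sineKernel_neg (c := c) (θ := θ) hk 0
  rw [neg_zero] at h
  exact self_eq_neg.1 h

lemma summable_fourier_sineKernel (hk : Odd k) (hc : 0 < c) (h0 : 0 < θ) (h1 : θ < 1) :
    Summable fun n : ℤ => 𝓕 (fun u => (sineKernel k c θ u : ℂ)) n := by
  have hs : 0 < 4 * Real.pi ^ 2 / c := by positivity
  have hp : Summable fun n : ℕ => 𝓕 (fun u => (sineKernel k c θ u : ℂ)) (n : ℝ) := by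
    rw [← summable_pnat_iff_summable_nat]
    have hd : Summable fun i : ℕ+ × ℕ+ => (i.2 : ℝ) ^ k * Real.sin (2 * Real.pi * i.2 * θ) *
        Real.exp (-(4 * Real.pi ^ 2 / c * i.1 * i.2)) := by
      refine Summable.of_norm_bounded (summable_pow_mul_exp_prod k hs) fun i => ?_
      rw [norm_mul, norm_mul, Real.norm_eq_abs, Real.norm_eq_abs, Real.norm_eq_abs, Real.abs_exp,
        abs_pow, Nat.abs_cast]
      gcongr
      exact mul_le_of_le_one_right (by positivity) (Real.abs_sin_le_one _)
    refine ((Complex.summable_ofReal.2 hd.prod).mul_left _).congr fun r =>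
      (fourier_sineKernel_eq hk hc h0 h1 (ξ := (r : ℕ)) (by exact_mod_cast r.pos)).symm
  refine Summable.of_nat_of_neg (by simpa using hp) (hp.neg.congr fun n => ?_)
  rw [← fourier_sineKernel_neg hk]
  push_cast
  rfl

lemma isBigO_sineKernel (hc : 0 < c) (h0 : 0 < θ) (h1 : θ < 1) :
    (fun u => (sineKernel k c θ u : ℂ)) =O[cocompact ℝ] fun u : ℝ => |u| ^ (-2 : ℝ) := by
  obtain ⟨C, hC0, hC⟩ := exists_abs_sineKernel_le (k := k) hc h0 h1
  refine Asymptotics.IsBigO.of_bound C ?_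
  filter_upwards [(isCompact_singleton (x := (0 : ℝ))).compl_mem_cocompact] with u hu
  have hu0 : u ≠ 0 := hu
  rw [Complex.norm_real, Real.norm_eq_abs, Real.norm_eq_abs, abs_of_nonneg (Real.rpow_nonneg (abs_nonneg u) _)]
  refine (hC _).trans (mul_le_mul_of_nonneg_left ?_ hC0)
  rw [Real.rpow_neg (abs_nonneg u), Real.rpow_two, sq_abs]
  gcongr
  linarith

/-- Poisson summation, after which the odd transform has no zero frequency and pairs ±r into 2i
sin(2πrψ). With the 2i from the sine series in θ this gives the factor -4. -/
lemma tsum_signedShift_expTerm_eq (hk : Odd k) (hc : 0 < c)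
    (h0 : 0 < θ) (h1 : θ < 1) (h2 : 0 < ψ) (h3 : ψ < 1) :
    ∑' i : ℕ × ℕ, signedShift (expTerm k c) θ ψ i.1 i.2
      = (-2 * Real.pi * I / c) ^ (k + 1) * (-4) *
        ∑' i : ℕ+ × ℕ+, (dampedSine k θ ψ (4 * Real.pi ^ 2 / c) i : ℂ) := by
  have hs : 0 < 4 * Real.pi ^ 2 / c := by positivity
  have hF := summable_fourier_sineKernel hk hc h0 h1
  have hsum : Summable fun n : ℤ => 𝓕 (fun u => (sineKernel k c θ u : ℂ)) n *
      fourier n (ψ : UnitAddCircle) := by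
    refine Summable.of_norm_bounded hF.norm fun n => ?_
    rw [norm_mul, fourier_apply, Circle.norm_coe, mul_one]
  rw [tsum_signedShift_expTerm hk hc h0 h1 h2 h3,
    Real.tsum_eq_tsum_fourier_of_rpow_decay_of_summable (f := fun u => (sineKernel k c θ u : ℂ))
      (continuous_ofReal.comp (continuous_sineKernel hk.pos.ne' hc h0 h1)) one_lt_two
      (isBigO_sineKernel hc h0 h1) hF,
    tsum_int_eq_zero_add_tsum_pnat hsum, Int.cast_zero, fourier_sineKernel_zero hk, zero_mul,
    zero_add]
  have hp : Summable fun n : ℕ+ => 𝓕 (fun u => (sineKernel k c θ u : ℂ)) ((n : ℤ) : ℝ) *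
      fourier (n : ℤ) (ψ : UnitAddCircle) :=
    hsum.comp_injective (Nat.cast_injective.comp PNat.coe_injective)
  have hn : Summable fun n : ℕ+ => 𝓕 (fun u => (sineKernel k c θ u : ℂ)) ((-(n : ℤ) : ℤ) : ℝ) *
      fourier (-(n : ℤ)) (ψ : UnitAddCircle) :=
    hsum.comp_injective (neg_injective.comp (Nat.cast_injective.comp PNat.coe_injective))
  have hds := Complex.summable_ofReal.2 (summable_dampedSine k θ ψ hs)
  rw [← hp.tsum_add hn, hds.tsum_prod, ← tsum_mul_left]
  refine tsum_congr fun r => ?_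
  have hr : (0 : ℝ) < (r : ℕ) := by exact_mod_cast r.pos
  have hT : ∑' d : ℕ+, (dampedSine k θ ψ (4 * Real.pi ^ 2 / c) (r, d) : ℂ) =
      Real.sin (2 * Real.pi * r * ψ) * ((∑' d : ℕ+, (d : ℝ) ^ k * Real.sin (2 * Real.pi * d * θ) *
        Real.exp (-(4 * Real.pi ^ 2 / c * (r : ℕ) * d)) : ℝ) : ℂ) := by
    rw [ofReal_tsum, ← tsum_mul_left]
    refine tsum_congr fun d => ?_
    rw [← ofReal_mul, dampedSine]
    congr 1
    ring
  rw [hT, Int.cast_neg, fourier_sineKernel_neg hk, Int.cast_natCast,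
    fourier_sineKernel_eq hk hc h0 h1 hr, fourier_coe_apply, fourier_coe_apply, ofReal_sin,
    Complex.sin]
  have e1 : 2 * Real.pi * I * ((r : ℤ) : ℂ) * ψ / (1 : ℝ) = ((2 * Real.pi * r * ψ : ℝ) : ℂ) * I := by
    push_cast
    ring
  have e2 : 2 * Real.pi * I * ((-(r : ℤ) : ℤ) : ℂ) * ψ / (1 : ℝ)
      = -((2 * Real.pi * r * ψ : ℝ) : ℂ) * I := by
    push_cast
    ring
  rw [e1, e2]
  ring

end

/-! ### Termwise integration on both sides -/

lemma HasSum.sum_divisors_pnat {g : ℕ → ℕ → ℂ} {S : ℂ}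
    (h : HasSum (fun i : ℕ+ × ℕ+ => g i.1 i.2) S) :
    HasSum (fun n : ℕ+ => ∑ d ∈ (n : ℕ).divisors, g (n / d) d) S := by
  rw [← sigmaAntidiagonalEquivProd.hasSum_iff] at h
  refine HasSum.sigma h fun n => ?_
  rw [← Nat.sum_divisorsAntidiagonal' (f := g), ← Finset.sum_coe_sort]
  exact hasSum_fintype _

/-- From e^(-y/t) ≤ M! (t/y)^M: decay in y to any order M, at the cost of shifting the Gamma
integral by M. -/
lemma integral_norm_besselMellin_le {ν : ℂ} {M : ℕ} (hν : 0 < ν.re) {y : ℝ} (hy : 0 < y) :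
    ∫ t in Ioi (0 : ℝ), ‖(t : ℂ) ^ (ν - 1) * ((Real.exp (-(t + y / t)) : ℝ) : ℂ)‖
      ≤ M.factorial * Real.Gamma (ν.re + M) / y ^ M := by
  have hσ : 0 < ν.re + M := by positivity
  have hG := Real.GammaIntegral_convergent hσ
  rw [Real.Gamma_eq_integral hσ, mul_div_right_comm, ← integral_const_mul]
  refine setIntegral_mono_on (mellinConvergent_exp_neg_add_div hy ν).norm (hG.const_mul _)
    measurableSet_Ioi fun t ht => ?_
  have ht' : 0 < t := ht
  rw [norm_cpow_mul_exp_eq ht', neg_add, Real.exp_add, sub_re, one_re]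
  have h := pow_mul_exp_neg_le hy (inv_pos.2 ht').le M
  rw [inv_pow, ← div_eq_mul_inv, inv_mul_le_iff₀ (by positivity)] at h
  calc _ ≤ t ^ (ν.re - 1) * (Real.exp (-t) * (t ^ M * (M.factorial / y ^ M))) := by gcongr
    _ = M.factorial / y ^ M * (Real.exp (-t) * (t ^ (ν.re - 1) * t ^ M)) := by ring
    _ = _ := by
      rw [← Real.rpow_natCast t M, ← Real.rpow_add ht']
      congr 3
      ring

/-- With z = a√(nx) one has (z/2)² = (a²x/4)n, so n^(ν/2) cancels exactly the n-dependence of the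
prefactor (z/2)^(-ν). -/
lemma natCast_cpow_mul_besselK {a x : ℝ} (ha : 0 < a) (hx : 0 < x) (ν : ℂ) {n : ℕ} (hn : 0 < n) :
    (n : ℂ) ^ (ν / 2) * besselK ν ((a * Real.sqrt (n * x) : ℝ) : ℂ)
      = 1 / 2 * ((a ^ 2 * x / 4 : ℝ) : ℂ) ^ (-(ν / 2)) * besselMellin ν (a ^ 2 * x / 4 * n) := by
  have hn' : (0 : ℝ) < n := by exact_mod_cast hn
  have hz : 0 < a * Real.sqrt (n * x) := by positivity
  have hA : 0 < a ^ 2 * x / 4 := by positivity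
  have hsq : (a * Real.sqrt (n * x)) ^ 2 = a ^ 2 * (n * x) := by
    rw [mul_pow, Real.sq_sqrt (by positivity)]
  have e1 : (a * Real.sqrt (n * x)) ^ 2 / 4 = a ^ 2 * x / 4 * n := by
    rw [hsq]
    ring
  have hn0 : (n : ℂ) ≠ 0 := by exact_mod_cast hn.ne'
  have e2 : ((a * Real.sqrt (n * x) / 2 : ℝ) : ℂ) ^ (-ν)
      = ((a ^ 2 * x / 4 : ℝ) : ℂ) ^ (-(ν / 2)) * (n : ℂ) ^ (-(ν / 2)) := by
    have e3 : ((a ^ 2 * x / 4 * n : ℝ) : ℂ) ^ (-(ν / 2)) =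
        ((a ^ 2 * x / 4 : ℝ) : ℂ) ^ (-(ν / 2)) * (n : ℂ) ^ (-(ν / 2)) := by
      rw [ofReal_mul, mul_cpow_ofReal_nonneg hA.le hn'.le, ofReal_natCast]
    rw [← e3, show a ^ 2 * x / 4 * n = (a * Real.sqrt (n * x) / 2) * (a * Real.sqrt (n * x) / 2) by
      rw [← e1]
      ring, ofReal_mul, mul_cpow_ofReal_nonneg (by positivity) (by positivity),
      ← cpow_add _ _ (by exact_mod_cast (by positivity : a * Real.sqrt (n * x) / 2 ≠ 0))]
    congr 1
    ring
  have e4 : (n : ℂ) ^ (ν / 2) * (n : ℂ) ^ (-(ν / 2)) = 1 := by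
    rw [← cpow_add _ _ hn0, add_neg_cancel, cpow_zero]
  rw [besselK_eq hz, e1, e2]
  linear_combination (1 / 2 * ((a ^ 2 * x / 4 : ℝ) : ℂ) ^ (-(ν / 2)) *
    besselMellin ν (a ^ 2 * x / 4 * n)) * e4

lemma summable_pnat_prod_rpow (k : ℕ) (C A : ℝ) :
    Summable fun i : ℕ+ × ℕ+ => (i.2 : ℝ) ^ k * (C / (A * i.1 * i.2) ^ (k + 2)) := by
  have h1 : Summable fun n : ℕ+ => 1 / ((n : ℕ) : ℝ) ^ (k + 2) :=
    summable_pnat_iff_summable_nat.2 (Real.summable_one_div_nat_pow.2 (by omega))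
  have h2 : Summable fun n : ℕ+ => 1 / ((n : ℕ) : ℝ) ^ 2 :=
    summable_pnat_iff_summable_nat.2 (Real.summable_one_div_nat_pow.2 (by omega))
  have h := (h1.mul_of_nonneg h2 (fun n => by positivity) (fun n => by positivity)).mul_left
    (C / A ^ (k + 2))
  refine h.congr fun i => ?_
  have : ((i.2 : ℕ) : ℝ) ≠ 0 := by exact_mod_cast i.2.ne_zero
  rw [mul_pow, mul_pow, pow_add ((i.2 : ℕ) : ℝ) k 2]
  field_simp

lemma abs_pow_mul_sin_mul_sin_le (k : ℕ) (d : ℕ) (α β : ℝ) :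
    |(d : ℝ) ^ k * Real.sin α * Real.sin β| ≤ (d : ℝ) ^ k := by
  rw [abs_mul, abs_mul, abs_pow, Nat.abs_cast]
  refine mul_le_of_le_one_right (by positivity) (Real.abs_sin_le_one _) |>.trans ?_
  exact mul_le_of_le_one_right (by positivity) (Real.abs_sin_le_one _)

/-- The interchange rests on decay of order k + 2 in Ard: against d^k it leaves r^(-(k+2)) d^(-2).
-/
lemma hasSum_sin_mul_besselMellin (k : ℕ) {ν : ℂ} (hν : 0 < ν.re) {A : ℝ} (hA : 0 < A)
    (θ ψ : ℝ) :
    HasSum (fun i : ℕ+ × ℕ+ => (((i.2 : ℝ) ^ k * Real.sin (2 * Real.pi * i.2 * θ) *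
        Real.sin (2 * Real.pi * i.1 * ψ) : ℝ) : ℂ) * besselMellin ν (A * i.1 * i.2))
      (∫ t in Ioi (0 : ℝ), (t : ℂ) ^ (ν - 1) * ((Real.exp (-t) : ℝ) : ℂ) *
        ∑' i : ℕ+ × ℕ+, (dampedSine k θ ψ (A / t) i : ℂ)) := by
  set w : ℕ+ × ℕ+ → ℝ := fun i => (i.2 : ℝ) ^ k * Real.sin (2 * Real.pi * i.2 * θ) *
        Real.sin (2 * Real.pi * i.1 * ψ) with hw
  set F : ℕ+ × ℕ+ → ℝ → ℂ := fun i t => (w i : ℂ) * ((t : ℂ) ^ (ν - 1) •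
    ((Real.exp (-(t + A * i.1 * i.2 / t)) : ℝ) : ℂ)) with hF
  have hy : ∀ i : ℕ+ × ℕ+, 0 < A * i.1 * i.2 := fun i => by
    have h1 : (0 : ℝ) < (i.1 : ℕ) := by exact_mod_cast i.1.pos
    have h2 : (0 : ℝ) < (i.2 : ℕ) := by exact_mod_cast i.2.pos
    positivity
  have hFi : ∀ i, IntegrableOn (F i) (Ioi 0) := fun i =>
    (mellinConvergent_exp_neg_add_div (hy i) ν).const_mul _
  have hFn : Summable fun i => ∫ t in Ioi (0 : ℝ), ‖F i t‖ := by
    refine Summable.of_nonneg_of_le (fun i => integral_nonneg fun t => norm_nonneg _) (fun i => ?_)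
      (summable_pnat_prod_rpow k ((k + 2).factorial * Real.Gamma (ν.re + (k + 2 : ℕ))) A)
    simp only [hF, norm_mul, integral_const_mul, smul_eq_mul]
    have h2 := integral_norm_besselMellin_le (M := k + 2) hν (hy i)
    simp only [norm_mul] at h2
    refine mul_le_mul ?_ h2 (integral_nonneg fun t => by positivity) (by positivity)
    rw [Complex.norm_real]
    exact abs_pow_mul_sin_mul_sin_le _ _ _ _
  have h := hasSum_integral_of_summable_integral_norm hFi hFn
  have hval : ∫ t in Ioi (0 : ℝ), ∑' i, F i t = ∫ t in Ioi (0 : ℝ), (t : ℂ) ^ (ν - 1) *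
      ((Real.exp (-t) : ℝ) : ℂ) * ∑' i : ℕ+ × ℕ+, (dampedSine k θ ψ (A / t) i : ℂ) := by
    refine setIntegral_congr_fun measurableSet_Ioi fun t ht => ?_
    rw [← tsum_mul_left]
    refine tsum_congr fun i => ?_
    simp only [hF, hw, dampedSine, smul_eq_mul, neg_add, Real.exp_add]
    rw [show A / t * i.1 * i.2 = A * i.1 * i.2 / t by ring]
    push_cast
    ring
  rw [hval] at h
  refine h.congr_fun fun i => ?_
  simp only [hF, integral_const_mul]
  rfl

lemma integral_cpow_mul_exp_mul_expTerm {k : ℕ} {ν : ℂ} (hν : 0 < ν.re) {c u v : ℝ} (hc : 0 < c)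
    (hu : 0 < u) (hv : 0 < v) :
    ∫ t in Ioi (0 : ℝ), (t : ℂ) ^ (ν + k) * ((Real.exp (-t) : ℝ) : ℂ) * expTerm k (c * t) u v
      = Gamma (ν + k + 1) * (((u ^ k : ℝ) : ℂ) / ((c * (u * v) + 1 : ℝ) : ℂ) ^ (ν + k + 1)) := by
  have hr : 0 < c * (u * v) + 1 := by positivity
  have h := integral_cpow_mul_exp_neg_mul_Ioi (a := ν + k + 1) (r := c * (u * v) + 1) (by
    simp only [add_re, natCast_re, one_re]
    positivity) hr
  have e : (1 / ((c * (u * v) + 1 : ℝ) : ℂ)) ^ (ν + k + 1) =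
      1 / ((c * (u * v) + 1 : ℝ) : ℂ) ^ (ν + k + 1) := by
    rw [one_div, one_div, inv_cpow]
    rw [arg_ofReal_of_nonneg hr.le]
    exact Real.pi_ne_zero.symm
  rw [e] at h
  have e2 : ∀ z w g : ℂ, g * (z / w) = z * (1 / w * g) := fun z w g => by ring
  rw [e2, ← h, ← integral_const_mul]
  refine setIntegral_congr_fun measurableSet_Ioi fun t ht => ?_
  simp only [expTerm, add_sub_cancel_right]
  push_cast
  rw [show -(((c : ℂ) * (u * v) + 1) * t) = -t + -(c * t * u * v) by ring, exp_add]
  ring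

lemma integrableOn_cpow_mul_exp_mul_expTerm {k : ℕ} {ν : ℂ} (hν : 0 < ν.re) {c u v : ℝ}
    (hc : 0 < c) (hu : 0 < u) (hv : 0 < v) :
    IntegrableOn (fun t : ℝ => (t : ℂ) ^ (ν + k) * ((Real.exp (-t) : ℝ) : ℂ) *
      expTerm k (c * t) u v) (Ioi 0) := by
  have hs : 0 < (ν + k + 1).re := by
    simp only [add_re, natCast_re, one_re]
    positivity
  refine Integrable.mono' ((GammaIntegral_convergent hs).norm.const_mul (u ^ k)) ?_ ?_
  · apply Measurable.aestronglyMeasurable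
    unfold expTerm
    fun_prop
  · filter_upwards [ae_restrict_mem measurableSet_Ioi] with t ht
    have ht' : 0 < t := ht
    rw [norm_mul, mul_comm, add_sub_cancel_right, mul_comm (ofReal _)]
    refine mul_le_mul_of_nonneg_right ?_ (norm_nonneg _)
    rw [expTerm, Complex.norm_real, Real.norm_eq_abs, abs_of_nonneg (by positivity)]
    refine mul_le_of_le_one_right (by positivity) (Real.exp_le_one_iff.2 ?_)
    have : 0 < c * t * u * v := by positivity
    linarith

/-- Dropping the +1 in cuv + 1 separates the variables. Re ν > 0 makes both exponents, Re ν + 1 and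
Re ν + k + 1, larger than 1, as required to sum over the lattice. -/
lemma integral_norm_cpow_mul_exp_mul_expTerm {k : ℕ} {ν : ℂ} (hν : 0 < ν.re) {c u v : ℝ}
    (hc : 0 < c) (hu : 0 < u) (hv : 0 < v) :
    ∫ t in Ioi (0 : ℝ), ‖(t : ℂ) ^ (ν + k) * ((Real.exp (-t) : ℝ) : ℂ) * expTerm k (c * t) u v‖
      ≤ Real.Gamma (ν.re + k + 1) / c ^ (ν.re + k + 1) *
        (u ^ (-(ν.re + 1)) * v ^ (-(ν.re + k + 1))) := by
  have hr : 0 < c * (u * v) + 1 := by positivity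
  have h := Real.integral_rpow_mul_exp_neg_mul_Ioi (a := ν.re + k + 1) (by positivity) hr
  have e : ∫ t in Ioi (0 : ℝ), ‖(t : ℂ) ^ (ν + k) * ((Real.exp (-t) : ℝ) : ℂ) *
      expTerm k (c * t) u v‖ = u ^ k * ((1 / (c * (u * v) + 1)) ^ (ν.re + k + 1) *
        Real.Gamma (ν.re + k + 1)) := by
    rw [← h, ← integral_const_mul]
    refine setIntegral_congr_fun measurableSet_Ioi fun t ht => ?_
    have ht' : 0 < t := ht
    rw [norm_mul, norm_cpow_mul_exp_eq ht', expTerm, Complex.norm_real, Real.norm_eq_abs,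
      abs_of_nonneg (by positivity), add_sub_cancel_right, add_re, natCast_re,
      show -((c * (u * v) + 1) * t) = -t + -(c * t * u * v) by ring, Real.exp_add]
    ring
  have hG : 0 < Real.Gamma (ν.re + k + 1) := Real.Gamma_pos_of_pos (by positivity)
  rw [e]
  have e3 : (1 / (c * (u * v) + 1)) ^ (ν.re + k + 1) ≤ (1 / (c * (u * v))) ^ (ν.re + k + 1) := by
    gcongr
    linarith
  calc _ ≤ u ^ k * ((1 / (c * (u * v))) ^ (ν.re + k + 1) * Real.Gamma (ν.re + k + 1)) := by gcongr
    _ = _ := by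
      rw [one_div, Real.inv_rpow (by positivity), Real.mul_rpow hc.le (by positivity),
        Real.mul_rpow hu.le hv.le, Real.rpow_neg hu.le, Real.rpow_neg hv.le,
        show ν.re + k + 1 = (ν.re + 1) + k by ring, Real.rpow_add hu, Real.rpow_natCast]
      field_simp

section

variable {k : ℕ} {ν : ℂ} {c θ ψ : ℝ}

lemma hasSum_integral_signedShift (hν : 0 < ν.re) (hc : 0 < c)
    (h0 : 0 < θ) (h1 : θ < 1) (h2 : 0 < ψ) (h3 : ψ < 1) :
    HasSum (fun i : ℕ × ℕ => Gamma (ν + k + 1) * signedShift (fun u v =>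
        ((u ^ k : ℝ) : ℂ) / ((c * (u * v) + 1 : ℝ) : ℂ) ^ (ν + k + 1)) θ ψ i.1 i.2)
      (∫ t in Ioi (0 : ℝ), (t : ℂ) ^ (ν + k) * ((Real.exp (-t) : ℝ) : ℂ) *
        ∑' i : ℕ × ℕ, signedShift (expTerm k (c * t)) θ ψ i.1 i.2) := by
  set E : ℝ → ℝ → ℝ → ℂ := fun u v t => (t : ℂ) ^ (ν + k) * ((Real.exp (-t) : ℝ) : ℂ) *
    expTerm k (c * t) u v with hE
  set N : ℝ → ℝ → ℝ := fun u v => ∫ t in Ioi (0 : ℝ), ‖E u v t‖ with hN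
  have hN0 : ∀ u v, 0 ≤ N u v := fun u v => integral_nonneg fun t => norm_nonneg _
  set F : ℕ × ℕ → ℝ → ℂ := fun i t => signedShift (fun u v => E u v t) θ ψ i.1 i.2 with hF
  have a1 : ∀ n : ℕ, (0 : ℝ) < n + ψ := fun n => by positivity
  have a2 : ∀ n : ℕ, (0 : ℝ) < n + 1 - ψ := fun n => by
    have : (0 : ℝ) ≤ n := n.cast_nonneg
    linarith
  have a3 : ∀ n : ℕ, (0 : ℝ) < n + θ := fun n => by positivity
  have a4 : ∀ n : ℕ, (0 : ℝ) < n + 1 - θ := fun n => by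
    have : (0 : ℝ) ≤ n := n.cast_nonneg
    linarith
  have hEi : ∀ {u v : ℝ}, 0 < u → 0 < v → IntegrableOn (E u v) (Ioi 0) :=
    fun hu hv => integrableOn_cpow_mul_exp_mul_expTerm hν hc hu hv
  have hFi : ∀ i, IntegrableOn (F i) (Ioi 0) := fun i =>
    (((hEi (a1 i.2) (a3 i.1)).sub (hEi (a2 i.2) (a3 i.1))).sub (hEi (a1 i.2) (a4 i.1))).add
      (hEi (a2 i.2) (a4 i.1))
  have hT : ∀ u v, 0 < u → 0 < v → ‖((N u v : ℝ) : ℂ)‖ ≤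
      Real.Gamma (ν.re + k + 1) / c ^ (ν.re + k + 1) *
        (u ^ (-(ν.re + 1)) * v ^ (-(ν.re + k + 1))) := fun u v hu hv => by
    rw [Complex.norm_real, Real.norm_eq_abs, abs_of_nonneg (hN0 u v)]
    exact integral_norm_cpow_mul_exp_mul_expTerm hν hc hu hv
  have hFn : Summable fun i => ∫ t in Ioi (0 : ℝ), ‖F i t‖ := by
    refine Summable.of_nonneg_of_le (fun i => integral_nonneg fun t => norm_nonneg _) (fun i => ?_)
      (summable_norm_shifts (by linarith) (by
        have : (0 : ℝ) ≤ k := k.cast_nonneg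
        linarith) hT h0 h1 h2 h3)
    simp only [Complex.norm_real, Real.norm_eq_abs, abs_of_nonneg (hN0 _ _)]
    simp only [hN]
    have i0 := (hEi (a1 i.2) (a3 i.1)).norm
    have i1 := (hEi (a2 i.2) (a3 i.1)).norm
    have i2 := (hEi (a1 i.2) (a4 i.1)).norm
    have i3 := (hEi (a2 i.2) (a4 i.1)).norm
    rw [← integral_add_add_add i0 i1 i2 i3]
    exact integral_mono (hFi i).norm ((i0.add i1).add (i2.add i3)) fun t =>
      norm_signedShift_le (fun u v => E u v t) θ ψ i.1 i.2
  have h := hasSum_integral_of_summable_integral_norm hFi hFn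
  have hval : ∫ t in Ioi (0 : ℝ), ∑' i, F i t = ∫ t in Ioi (0 : ℝ), (t : ℂ) ^ (ν + k) *
      ((Real.exp (-t) : ℝ) : ℂ) * ∑' i : ℕ × ℕ, signedShift (expTerm k (c * t)) θ ψ i.1 i.2 := by
    refine setIntegral_congr_fun measurableSet_Ioi fun t ht => ?_
    rw [← tsum_mul_left]
    refine tsum_congr fun i => ?_
    simp only [hF, hE, signedShift]
    ring
  rw [hval] at h
  refine h.congr_fun fun i => ?_
  have e : ∀ {u v : ℝ}, 0 < u → 0 < v → ∫ t in Ioi (0 : ℝ), E u v t = Gamma (ν + k + 1) *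
      (((u ^ k : ℝ) : ℂ) / ((c * (u * v) + 1 : ℝ) : ℂ) ^ (ν + k + 1)) :=
    fun hu hv => integral_cpow_mul_exp_mul_expTerm hν hc hu hv
  have hs := integral_sub_sub_sub (hEi (a1 i.2) (a3 i.1)) (hEi (a2 i.2) (a3 i.1))
    (hEi (a1 i.2) (a4 i.1)) (hEi (a2 i.2) (a4 i.1))
  rw [e (a1 _) (a3 _), e (a2 _) (a3 _), e (a1 _) (a4 _), e (a2 _) (a4 _)] at hs
  have hs2 : ∫ t in Ioi (0 : ℝ), F i t = _ := Eq.trans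
    (setIntegral_congr_fun measurableSet_Ioi fun t ht => by
      simp only [hF, signedShift]
      ring) hs
  rw [hs2, signedShift]
  ring

end

/-! ### The identity with two sines -/

lemma neg_I_mul_pow_of_odd {k : ℕ} (hk : Odd k) (z : ℂ) :
    (-I * z) ^ (k + 1) = (-1) ^ ((k + 1) / 2) * z ^ (k + 1) := by
  obtain ⟨m, rfl⟩ := hk
  rw [mul_pow, show 2 * m + 1 + 1 = 2 * (m + 1) by ring, pow_mul (-I), neg_sq, I_sq,
    Nat.mul_div_cancel_left _ two_pos]

/-- The series with two sines equals the signed double series. -/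
theorem sineIdentity {k : ℕ} (hk : Odd k) {ν : ℂ} (hν : 0 < ν.re) {a x θ ψ : ℝ} (ha : 0 < a)
    (hx : 0 < x) (h0 : 0 < θ) (h1 : θ < 1) (h2 : 0 < ψ) (h3 : ψ < 1) :
    SineIdentity k ν a x θ ψ := by
  set A := a ^ 2 * x / 4 with hA
  have hA0 : 0 < A := by positivity
  have hAc : (A : ℂ) ≠ 0 := by exact_mod_cast hA0.ne'
  have hπ : (Real.pi : ℂ) ≠ 0 := by exact_mod_cast Real.pi_ne_zero
  have hG : Gamma (ν + k + 1) ≠ 0 := Gamma_ne_zero_of_re_pos (by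
    simp only [add_re, natCast_re, one_re]
    positivity)
  set S := ∫ t in Ioi (0 : ℝ), (t : ℂ) ^ (ν - 1) * ((Real.exp (-t) : ℝ) : ℂ) *
        ∑' i : ℕ+ × ℕ+, (dampedSine k θ ψ (A / t) i : ℂ) with hS
  have hL : HasSum (fun n : ℕ+ => ((n : ℕ) : ℂ) ^ (ν / 2) *
      besselK ν ((a * Real.sqrt ((n : ℕ) * x) : ℝ) : ℂ) * (sinSinDivisorSum k θ ψ n : ℂ))
      (1 / 2 * (A : ℂ) ^ (-(ν / 2)) * S) := by
    refine ((HasSum.sum_divisors_pnat (g := fun r d => (((d : ℝ) ^ k *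
      Real.sin (2 * Real.pi * d * θ) * Real.sin (2 * Real.pi * r * ψ) : ℝ) : ℂ) *
      besselMellin ν (A * r * d)) (hasSum_sin_mul_besselMellin k hν hA0 θ ψ)).mul_left
      (1 / 2 * (A : ℂ) ^ (-(ν / 2)))).congr_fun fun n => ?_
    rw [natCast_cpow_mul_besselK ha hx ν n.pos, sinSinDivisorSum, mul_assoc, ofReal_sum,
      Finset.mul_sum]
    congr 1
    refine Finset.sum_congr rfl fun d hd => ?_
    have hdn : d ∣ n := (Nat.mem_divisors.1 hd).1
    have hd0 : (d : ℝ) ≠ 0 := by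
      exact_mod_cast (Nat.pos_of_mem_divisors hd).ne'
    rw [Nat.cast_div hdn hd0, mul_comm (besselMellin _ _), mul_assoc A, div_mul_cancel₀ _ hd0,
      show 2 * Real.pi * (n : ℕ) * ψ / d = 2 * Real.pi * ((n : ℕ) / d) * ψ by ring]
  set c := 16 * Real.pi ^ 2 / (a ^ 2 * x) with hc
  have hc0 : 0 < c := by positivity
  -- This relation makes the dual damping parameter 4π²/(ct) equal to A/t, so both sides become
  -- multiples of the same integral S.
  have hcA : c = 4 * Real.pi ^ 2 / A := by
    rw [hc, hA]
    field_simp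
    norm_num
  have hR : HasSum (fun i : ℕ × ℕ => Gamma (ν + k + 1) * signedTerm k ν a x θ ψ i.1 i.2)
      ((-1) ^ ((k + 1) / 2) * (A / (2 * Real.pi)) ^ (k + 1) * (-4) * S) := by
    have h := hasSum_integral_signedShift (k := k) hν hc0 h0 h1 h2 h3
    have hval : ∫ t in Ioi (0 : ℝ), (t : ℂ) ^ (ν + k) * ((Real.exp (-t) : ℝ) : ℂ) *
        ∑' i : ℕ × ℕ, signedShift (expTerm k (c * t)) θ ψ i.1 i.2 =
        (-1) ^ ((k + 1) / 2) * (A / (2 * Real.pi)) ^ (k + 1) * (-4) * S := by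
      rw [hS, ← integral_const_mul]
      refine setIntegral_congr_fun measurableSet_Ioi fun t ht => ?_
      have ht' : 0 < t := ht
      have htc : (t : ℂ) ≠ 0 := by exact_mod_cast ht'.ne'
      rw [tsum_signedShift_expTerm_eq hk (mul_pos hc0 ht') h0 h1 h2 h3,
        show 4 * Real.pi ^ 2 / (c * t) = A / t by
          rw [hcA]
          field_simp,
        show -2 * Real.pi * I / ((c * t : ℝ) : ℂ) = -I * (A / (2 * Real.pi) * (1 / t)) by
          rw [hcA]
          push_cast
          field_simp
          norm_num,
        neg_I_mul_pow_of_odd hk, mul_pow (A / (2 * Real.pi) : ℂ), one_div, inv_pow]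
      -- The factor t^(-(k+1)) produced by Poisson summation lowers the weight t^(ν+k) to the weight
      -- t^(ν-1) of the Bessel side.
      have e : (t : ℂ) ^ (ν + k) * ((t : ℂ) ^ (k + 1))⁻¹ = (t : ℂ) ^ (ν - 1) := by
        rw [← cpow_natCast, ← cpow_neg, ← cpow_add _ _ htc]
        congr 1
        push_cast
        ring
      rw [← e]
      ring
    rw [hval] at h
    refine h.congr_fun fun i => ?_
    have ec : ∀ u v : ℝ, 16 * Real.pi ^ 2 / a ^ 2 * (u * v / x) = c * (u * v) := fun u v => by
      rw [hc]
      field_simp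
    simp only [signedTerm, signedShift, rieszTerm, ec]
  refine ⟨hL.summable, ?_, ?_⟩
  · exact (summable_mul_left_iff hG).1 hR.summable
  · have hR' := hR.tsum_eq
    rw [tsum_mul_left] at hR'
    have e1 : (A : ℂ) ^ (ν / 2 + k + 1) * (A : ℂ) ^ (-(ν / 2)) = (A : ℂ) ^ (k + 1) := by
      rw [← cpow_add _ _ hAc, ← cpow_natCast]
      congr 1
      push_cast
      ring
    have e2 : ((-1 : ℂ) ^ ((k + 1) / 2)) * (-1) ^ ((k + 1) / 2) = 1 := by
      rw [← mul_pow]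
      simp
    have e3 : (2 * (Real.pi : ℂ)) ^ (k + 1) * (A / (2 * Real.pi)) ^ (k + 1) = (A : ℂ) ^ (k + 1) := by
      rw [← mul_pow]
      congr 1
      field_simp
    rw [hL.tsum_eq, mul_assoc _ (Gamma _), hR']
    linear_combination (1 / 2 * S) * e1 - (1 / 2 * S * (A : ℂ) ^ (k + 1)) * e2 -
      (1 / 2 * S * ((-1 : ℂ) ^ ((k + 1) / 2)) * (-1) ^ ((k + 1) / 2)) * e3

/-! ### Gauss sums of odd primitive characters -/

section

variable {p : ℕ} {χ : DirichletCharacter ℂ p}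

lemma DirichletCharacter.IsPrimitive.inv (h : χ.IsPrimitive) : χ⁻¹.IsPrimitive := by
  rw [DirichletCharacter.isPrimitive_def] at h ⊢
  rw [DirichletCharacter.conductor_inv, h]

lemma DirichletCharacter.Odd.inv (h : χ.Odd) : χ⁻¹.Odd := by
  unfold DirichletCharacter.Odd at h ⊢
  rw [← MulChar.star_eq_inv, MulChar.star_apply, h]
  simp

lemma DirichletCharacter.Odd.map_zero (h : χ.Odd) : χ 0 = 0 := by
  have h0 := h.eval_neg _ 0
  rw [neg_zero] at h0
  exact self_eq_neg.1 h0

variable [NeZero p]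

/-- Apply the discrete Fourier transform twice and evaluate at -1; for primitive χ each value of the
transform is a Gauss sum times χ⁻¹, and oddness supplies the sign. -/
lemma tauSum_mul_tauSum_inv (hp : χ.IsPrimitive) (ho : χ.Odd) :
    tauSum χ * tauSum χ⁻¹ = -p := by
  have h := congrFun (ZMod.dft_dft (χ : ZMod p → ℂ)) (-1)
  rw [ZMod.dft_apply] at h
  simp only [hp.fourierTransform_eq_inv_mul_gaussSum, neg_neg, map_one, smul_eq_mul, mul_one,
    mul_neg, ho.inv.eval_neg] at h
  rw [tauSum, tauSum, ← h, show gaussSum χ⁻¹ ZMod.stdAddChar =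
    ∑ j, χ⁻¹ j * ZMod.stdAddChar j from rfl, Finset.mul_sum, ← Finset.sum_neg_distrib]
  refine Finset.sum_congr rfl fun j _ => ?_
  ring

lemma tauSum_inv_ne_zero (hp : χ.IsPrimitive) (ho : χ.Odd) : tauSum χ⁻¹ ≠ 0 := by
  intro h
  have h1 := tauSum_mul_tauSum_inv hp ho
  rw [h, mul_zero, eq_comm, neg_eq_zero] at h1
  exact NeZero.ne p (by exact_mod_cast h1)

/-- Primitivity gives ∑ χ⁻¹(h) e(dh/p) = χ(d) τ(χ⁻¹) for every d, coprime to p or not. The values at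
d and -d differ by a sign, so the sine combination keeps them. -/
lemma sum_inv_mul_sin (hp : χ.IsPrimitive) (ho : χ.Odd) (d : ℕ) :
    ∑ h : ZMod p, χ⁻¹ h * (Real.sin (2 * Real.pi * d * (h.val / p)) : ℂ)
      = -I * χ (d : ZMod p) * tauSum χ⁻¹ := by
  have h1 := gaussSum_mulShift_of_isPrimitive (ZMod.stdAddChar (N := p)) hp.inv (d : ZMod p)
  have h2 := gaussSum_mulShift_of_isPrimitive (ZMod.stdAddChar (N := p)) hp.inv (-d : ZMod p)
  rw [inv_inv, gaussSum] at h1 h2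
  rw [ho.eval_neg] at h2
  simp only [AddChar.mulShift_apply] at h1 h2
  have e : ∀ h : ZMod p, ZMod.stdAddChar ((d : ZMod p) * h)
      = exp (((2 * Real.pi * d * (h.val / p) : ℝ) : ℂ) * I) := fun h => by
    have := ZMod.stdAddChar_coe (N := p) ((d * h.val : ℕ) : ℤ)
    push_cast at this
    rw [ZMod.natCast_zmod_val] at this
    rw [this]
    congr 1
    push_cast
    ring
  have e' : ∀ h : ZMod p, ZMod.stdAddChar (-(d : ZMod p) * h)
      = exp (-((2 * Real.pi * d * (h.val / p) : ℝ) : ℂ) * I) := fun h => by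
    rw [neg_mul, AddChar.map_neg_eq_inv, e, ← exp_neg, neg_mul]
  simp only [e] at h1
  simp only [e'] at h2
  have h3 : ∑ h : ZMod p, χ⁻¹ h * (Real.sin (2 * Real.pi * d * (h.val / p)) : ℂ) =
      ((∑ h : ZMod p, χ⁻¹ h * exp (-((2 * Real.pi * d * (h.val / p) : ℝ) : ℂ) * I)) -
        ∑ h : ZMod p, χ⁻¹ h * exp (((2 * Real.pi * d * (h.val / p) : ℝ) : ℂ) * I)) * I / 2 := by
    rw [← Finset.sum_sub_distrib, Finset.sum_mul, Finset.sum_div]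
    refine Finset.sum_congr rfl fun h _ => ?_
    rw [ofReal_sin, Complex.sin]
    ring
  rw [h3, h1, h2, tauSum]
  ring

end

/-! ### From the sine identity to characters -/

section

variable {k : ℕ} {p q : ℕ} [NeZero p] [NeZero q] {χ₁ : DirichletCharacter ℂ p}
  {χ₂ : DirichletCharacter ℂ q}

/-- For d dividing n the second sine depends on n/d only, so the double sum factors into two twisted
sine sums; the sign is (-i)². -/
lemma sum_inv_mul_sinSinDivisorSum (h1 : χ₁.IsPrimitive) (h2 : χ₂.IsPrimitive) (o1 : χ₁.Odd)
    (o2 : χ₂.Odd) (n : ℕ+) :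
    ∑ i : ZMod p × ZMod q, χ₁⁻¹ i.1 * χ₂⁻¹ i.2 *
        (sinSinDivisorSum k (i.1.val / p) (i.2.val / q) n : ℂ)
      = -(tauSum χ₁⁻¹ * tauSum χ₂⁻¹) * twistedSigma k χ₁ χ₂ n := by
  simp only [sinSinDivisorSum, twistedSigma, ofReal_sum, Finset.mul_sum]
  rw [Finset.sum_comm]
  refine Finset.sum_congr rfl fun d hd => ?_
  have hdn : d ∣ n := (Nat.mem_divisors.1 hd).1
  have hd0 : (d : ℝ) ≠ 0 := by exact_mod_cast (Nat.pos_of_mem_divisors hd).ne'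
  have e1 := sum_inv_mul_sin h1 o1 d
  have e2 := sum_inv_mul_sin h2 o2 (n / d)
  have e3 : ∑ i : ZMod p × ZMod q, χ₁⁻¹ i.1 * χ₂⁻¹ i.2 *
      (((d : ℝ) ^ k * Real.sin (2 * Real.pi * d * (i.1.val / p)) *
        Real.sin (2 * Real.pi * (n : ℕ) * (i.2.val / q) / d) : ℝ) : ℂ) =
      (d : ℂ) ^ k * ((∑ h : ZMod p, χ₁⁻¹ h * (Real.sin (2 * Real.pi * d * (h.val / p)) : ℂ)) *
        ∑ j : ZMod q, χ₂⁻¹ j * (Real.sin (2 * Real.pi * ((n / d : ℕ) : ℕ) * (j.val / q)) : ℂ)) := by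
    rw [Finset.sum_mul_sum, ← Finset.univ_product_univ, Finset.sum_product, Finset.mul_sum]
    refine Finset.sum_congr rfl fun h _ => ?_
    rw [Finset.mul_sum]
    refine Finset.sum_congr rfl fun j _ => ?_
    rw [Nat.cast_div hdn hd0, show 2 * Real.pi * (n : ℕ) * ((j.val : ℝ) / q) / d =
      2 * Real.pi * ((n : ℕ) / d) * (j.val / q) by ring]
    push_cast
    ring
  rw [e3, e1, e2]
  linear_combination (d : ℂ) ^ k * χ₁ (d : ZMod p) * tauSum χ₁⁻¹ *
    χ₂ ((n / d : ℕ) : ZMod q) * tauSum χ₂⁻¹ * I_sq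

/-- The twisted Riesz term attached to the pair `(M, N)`. -/
def twistedRieszTerm (k : ℕ) (ν : ℂ) (a x : ℝ) (χ₁ : DirichletCharacter ℂ p)
    (χ₂ : DirichletCharacter ℂ q) (M N : ℕ) : ℂ :=
  χ₁⁻¹ (M : ZMod p) * χ₂⁻¹ (N : ZMod q) * ((N : ℂ) ^ k /
    ((16 * Real.pi ^ 2 / (a ^ 2 * p * q) * ((M * N : ℕ) / x) + 1 : ℝ) : ℂ) ^ (ν + k + 1))

lemma DirichletCharacter.norm_inv_le_one {N : ℕ} (χ : DirichletCharacter ℂ N) (z : ZMod N) :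
    ‖χ⁻¹ z‖ ≤ 1 := DirichletCharacter.norm_le_one _ _

lemma summable_twistedRieszTerm {ν : ℂ} (hν : 0 < ν.re) {a x : ℝ} (ha : 0 < a) (hx : 0 < x)
    (χ₁ : DirichletCharacter ℂ p) (χ₂ : DirichletCharacter ℂ q) :
    Summable fun i : ℕ+ × ℕ+ => twistedRieszTerm k ν a x χ₁ χ₂ i.1 i.2 := by
  have hp : (0 : ℝ) < p := by exact_mod_cast NeZero.pos p
  have hq : (0 : ℝ) < q := by exact_mod_cast NeZero.pos q
  set c := 16 * Real.pi ^ 2 / (a ^ 2 * p * q * x) with hc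
  have hc0 : 0 < c := by positivity
  have hs : ∀ {r : ℝ}, 1 < r → Summable fun n : ℕ+ => ((n : ℕ) : ℝ) ^ (-r) := fun hr =>
    summable_pnat_iff_summable_nat.2 (Real.summable_nat_rpow.2 (by linarith))
  have hs1 := (hs (r := ν.re + k + 1) (by
    have : (0 : ℝ) ≤ k := k.cast_nonneg
    linarith)).mul_of_nonneg (hs (r := ν.re + 1) (by linarith)) (fun n => by positivity)
    (fun n => by positivity)
  refine Summable.of_norm_bounded (hs1.mul_left (c ^ (-(ν.re + k + 1)))) fun i => ?_
  have hM : (0 : ℝ) < (i.1 : ℕ) := by exact_mod_cast i.1.pos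
  have hN : (0 : ℝ) < (i.2 : ℕ) := by exact_mod_cast i.2.pos
  have e : 16 * Real.pi ^ 2 / (a ^ 2 * p * q) * ((((i.1 : ℕ) * (i.2 : ℕ) : ℕ) : ℝ) / x) + 1
      = c * ((i.1 : ℕ) * (i.2 : ℕ)) + 1 := by
    rw [hc]
    push_cast
    field_simp
  have hb : 0 < c * ((i.1 : ℕ) * (i.2 : ℕ) : ℝ) := by positivity
  rw [twistedRieszTerm, e, norm_mul, norm_mul, norm_div, norm_cpow_eq_rpow_re_of_pos (by linarith),
    norm_pow, Complex.norm_natCast, add_re, add_re, natCast_re, one_re]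
  have h1 : ‖χ₁⁻¹ ((i.1 : ℕ) : ZMod p)‖ * ‖χ₂⁻¹ ((i.2 : ℕ) : ZMod q)‖ ≤ 1 :=
    mul_le_one₀ (χ₁.norm_inv_le_one _) (norm_nonneg _) (χ₂.norm_inv_le_one _)
  have h2 : (c * ((i.1 : ℕ) * (i.2 : ℕ) : ℝ)) ^ (ν.re + k + 1) ≤
      (c * ((i.1 : ℕ) * (i.2 : ℕ) : ℝ) + 1) ^ (ν.re + k + 1) := by
    gcongr
    linarith
  calc _ ≤ 1 * (((i.2 : ℕ) : ℝ) ^ k / (c * ((i.1 : ℕ) * (i.2 : ℕ) : ℝ)) ^ (ν.re + k + 1)) := by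
        gcongr
    _ = _ := by
        rw [Real.mul_rpow hc0.le (by positivity), Real.mul_rpow hM.le hN.le,
          Real.rpow_neg hc0.le, Real.rpow_neg hM.le, Real.rpow_neg hN.le,
          show ν.re + k + 1 = (ν.re + 1) + k by ring, Real.rpow_add hN, Real.rpow_natCast]
        field_simp

/-- Odd characters vanish at 0, so the pairs with a zero entry can be added for free; the pairs of
naturals are then split into residue classes mod p and mod q. -/
lemma hasSum_twistedRieszTerm_nat (o1 : χ₁.Odd) (o2 : χ₂.Odd) {ν : ℂ} {a x : ℝ} {S : ℂ}
    (h : HasSum (fun i : ℕ+ × ℕ+ => twistedRieszTerm k ν a x χ₁ χ₂ i.1 i.2) S) :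
    HasSum (fun i : ℕ × ℕ => ∑ r : ZMod p × ZMod q,
      twistedRieszTerm k ν a x χ₁ χ₂ (r.1.val + p * i.1) (r.2.val + q * i.2)) S := by
  have hinj : Function.Injective fun i : ℕ+ × ℕ+ => ((i.1 : ℕ), (i.2 : ℕ)) := fun i j hij => by
    rw [Prod.mk.injEq] at hij
    exact Prod.ext (PNat.coe_injective hij.1) (PNat.coe_injective hij.2)
  have h1 : HasSum (fun i : ℕ × ℕ => twistedRieszTerm k ν a x χ₁ χ₂ i.1 i.2) S := by
    refine (hinj.hasSum_iff fun i hi => ?_).1 h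
    have h0 : i.1 = 0 ∨ i.2 = 0 := by
      by_contra! hne
      exact hi ⟨(⟨i.1, Nat.pos_of_ne_zero hne.1⟩, ⟨i.2, Nat.pos_of_ne_zero hne.2⟩), rfl⟩
    rcases h0 with h0 | h0
    · simp [twistedRieszTerm, h0, o1.inv.map_zero]
    · simp [twistedRieszTerm, h0, o2.inv.map_zero]
  rw [← ((Nat.residueClassesEquiv p).symm.prodCongr (Nat.residueClassesEquiv q).symm).hasSum_iff,
    ← (Equiv.prodProdProdComm (ZMod p) (ZMod q) ℕ ℕ).hasSum_iff,
    ← (Equiv.prodComm (ℕ × ℕ) (ZMod p × ZMod q)).hasSum_iff] at h1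
  exact h1.prod_fiberwise fun i => hasSum_fintype _

end

lemma twistedSigma_star_mul {k p q : ℕ} (χ₁ : DirichletCharacter ℂ p)
    (χ₂ : DirichletCharacter ℂ q) (ν : ℂ) (a x : ℝ) (n : ℕ+) :
    twistedSigma k (star χ₂) (star χ₁) n * (Gamma (ν + k + 1) /
        ((16 * Real.pi ^ 2 / (a ^ 2 * p * q) * ((n : ℕ) / x) + 1 : ℝ) : ℂ) ^ (ν + k + 1))
      = Gamma (ν + k + 1) * ∑ d ∈ (n : ℕ).divisors,
        twistedRieszTerm k ν a x χ₁ χ₂ ((n : ℕ) / d) d := by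
  rw [twistedSigma, Finset.sum_mul, Finset.mul_sum]
  refine Finset.sum_congr rfl fun d hd => ?_
  rw [twistedRieszTerm, Nat.div_mul_cancel (Nat.mem_divisors.1 hd).1, MulChar.star_eq_inv,
    MulChar.star_eq_inv]
  ring

section

variable {k : ℕ} {p q : ℕ} [NeZero p] [NeZero q] {χ₁ : DirichletCharacter ℂ p}
  {χ₂ : DirichletCharacter ℂ q}

lemma rieszTerm_eq_twistedRieszTerm (ν : ℂ) (a x : ℝ) (h : ZMod p) (j : ZMod q) (m n : ℕ) :
    χ₁⁻¹ h * χ₂⁻¹ j * rieszTerm k ν a x (n + j.val / q) (m + h.val / p)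
      = ((q : ℂ) ^ k)⁻¹ * twistedRieszTerm k ν a x χ₁ χ₂ (h.val + p * m) (j.val + q * n) := by
  have hp : (p : ℝ) ≠ 0 := by exact_mod_cast NeZero.ne p
  have hq : (q : ℝ) ≠ 0 := by exact_mod_cast NeZero.ne q
  have e1 : ((h.val + p * m : ℕ) : ZMod p) = h := by simp
  have e2 : ((j.val + q * n : ℕ) : ZMod q) = j := by simp
  have e3 : (n : ℝ) + j.val / q = ((j.val + q * n : ℕ) : ℝ) / q := by
    push_cast
    field_simp
    ring
  have e4 : (m : ℝ) + h.val / p = ((h.val + p * m : ℕ) : ℝ) / p := by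
    push_cast
    field_simp
    ring
  rw [twistedRieszTerm, rieszTerm, e1, e2, e3, e4]
  generalize j.val + q * n = N
  generalize h.val + p * m = M
  have e5 : 16 * Real.pi ^ 2 / a ^ 2 * ((N : ℝ) / q * ((M : ℝ) / p) / x)
      = 16 * Real.pi ^ 2 / (a ^ 2 * p * q) * (((M * N : ℕ) : ℝ) / x) := by
    push_cast
    field_simp
  rw [e5, div_pow]
  push_cast
  ring

/-- Reflecting h ↦ -h or j ↦ -j flips the sign of the weight and turns 1 - h/p or 1 - j/q into a
standard residue, so the signed terms add up to four copies of one sum. The residue 0, for which the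
reflection fails, carries weight 0. -/
lemma sum_inv_mul_signedTerm (o1 : χ₁.Odd) (o2 : χ₂.Odd) (ν : ℂ) (a x : ℝ) (m n : ℕ) :
    ∑ r : ZMod p × ZMod q, χ₁⁻¹ r.1 * χ₂⁻¹ r.2 *
        signedTerm k ν a x (r.1.val / p) (r.2.val / q) m n
      = 4 * ((q : ℂ) ^ k)⁻¹ * ∑ r : ZMod p × ZMod q,
        twistedRieszTerm k ν a x χ₁ χ₂ (r.1.val + p * m) (r.2.val + q * n) := by
  have hp : (p : ℝ) ≠ 0 := by exact_mod_cast NeZero.ne p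
  have hq : (q : ℝ) ≠ 0 := by exact_mod_cast NeZero.ne q
  set f : ZMod p → ZMod q → ℂ := fun h j =>
    rieszTerm k ν a x (n + j.val / q) (m + h.val / p) with hf
  set w : ZMod p → ZMod q → ℂ := fun h j => χ₁⁻¹ h * χ₂⁻¹ j with hw
  have hval : ∀ {N : ℕ} [NeZero N] {z : ZMod N} (t : ℕ), z ≠ 0 →
      (t : ℝ) + 1 - z.val / N = t + (-z).val / N := by
    intro N _ z t hz
    have hN : (N : ℝ) ≠ 0 := by exact_mod_cast NeZero.ne N
    rw [ZMod.neg_val, if_neg hz, Nat.cast_sub z.val_lt.le]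
    field_simp
    ring
  have hterm : ∀ h j, w h j * signedTerm k ν a x (h.val / p) (j.val / q) m n =
      w h j * f h j - w h j * f h (-j) - w h j * f (-h) j + w h j * f (-h) (-j) := by
    intro h j
    rcases eq_or_ne h 0 with rfl | hh
    · simp [hw, o1.inv.map_zero]
    rcases eq_or_ne j 0 with rfl | hj
    · simp [hw, o2.inv.map_zero]
    simp only [hf, signedTerm, hval n hj, hval m hh]
    ring
  have hn1 : ∀ h j, w (-h) j = -w h j := fun h j => by
    simp only [hw, o1.inv.eval_neg, neg_mul]
  have hn2 : ∀ h j, w h (-j) = -w h j := fun h j => by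
    simp only [hw, o2.inv.eval_neg, mul_neg]
  set W := ∑ r : ZMod p × ZMod q, w r.1 r.2 * f r.1 r.2 with hW
  have s1 : ∑ r : ZMod p × ZMod q, w r.1 r.2 * f r.1 (-r.2) = -W := by
    rw [hW, ← Finset.sum_neg_distrib,
      ← ((Equiv.refl (ZMod p)).prodCongr (Equiv.neg (ZMod q))).sum_comp]
    refine Finset.sum_congr rfl fun r _ => ?_
    simp [hn2]
  have s2 : ∑ r : ZMod p × ZMod q, w r.1 r.2 * f (-r.1) r.2 = -W := by
    rw [hW, ← Finset.sum_neg_distrib,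
      ← ((Equiv.neg (ZMod p)).prodCongr (Equiv.refl (ZMod q))).sum_comp]
    refine Finset.sum_congr rfl fun r _ => ?_
    simp [hn1]
  have s3 : ∑ r : ZMod p × ZMod q, w r.1 r.2 * f (-r.1) (-r.2) = W := by
    rw [hW, ← ((Equiv.neg (ZMod p)).prodCongr (Equiv.neg (ZMod q))).sum_comp]
    refine Finset.sum_congr rfl fun r _ => ?_
    simp [hn1, hn2]
  have hWt : W = ((q : ℂ) ^ k)⁻¹ * ∑ r : ZMod p × ZMod q,
      twistedRieszTerm k ν a x χ₁ χ₂ (r.1.val + p * m) (r.2.val + q * n) := by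
    rw [hW, Finset.mul_sum]
    exact Finset.sum_congr rfl fun r _ => rieszTerm_eq_twistedRieszTerm ν a x r.1 r.2 m n
  have hmain : ∑ r : ZMod p × ZMod q, w r.1 r.2 *
      signedTerm k ν a x (r.1.val / p) (r.2.val / q) m n = 4 * W := by
    simp only [hterm, Finset.sum_add_distrib, Finset.sum_sub_distrib, s1, s2, s3]
    ring
  rw [mul_assoc, ← hWt]
  exact hmain

/-- Summability is required only at nonzero weights because the sine identity is available only for
parameters strictly between 0 and 1, hence not at the residue 0. -/
lemma hasSum_sum_mul_of_ne_zero {ι κ : Type*} [Fintype κ] {w : κ → ℂ} {f : κ → ι → ℂ}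
    (h : ∀ r, w r ≠ 0 → Summable (f r)) :
    HasSum (fun i => ∑ r, w r * f r i) (∑ r, w r * ∑' i, f r i) := by
  refine hasSum_sum fun r _ => ?_
  rcases eq_or_ne (w r) 0 with h0 | h0
  · simp [h0]
  · exact (h r h0).hasSum.mul_left _

/-- The identities with two sines at all rational points imply the character analogue. -/
theorem characterIdentity_of_sineIdentity {ν : ℂ} (hν : 0 < ν.re) {a x : ℝ} (ha : 0 < a)
    (hx : 0 < x)
    (H : ∀ θ ψ : ℝ, 0 < θ → θ < 1 → 0 < ψ → ψ < 1 → SineIdentity k ν a x θ ψ)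
    (h1 : χ₁.IsPrimitive) (h2 : χ₂.IsPrimitive) (o1 : χ₁.Odd) (o2 : χ₂.Odd) :
    CharacterIdentity k ν a x χ₁ χ₂ := by
  have hp : (p : ℂ) ≠ 0 := by exact_mod_cast NeZero.ne p
  have hq : (q : ℂ) ≠ 0 := by exact_mod_cast NeZero.ne q
  have hpt : ∀ {N : ℕ} [NeZero N] {z : ZMod N}, z ≠ 0 →
      (0 : ℝ) < z.val / N ∧ (z.val : ℝ) / N < 1 := by
    intro N _ z hz
    have hN : (0 : ℝ) < N := by exact_mod_cast NeZero.pos N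
    have hz' : (0 : ℝ) < z.val := by
      exact_mod_cast Nat.pos_of_ne_zero fun h => hz ((ZMod.val_eq_zero z).1 h)
    refine ⟨by positivity, (div_lt_one hN).2 ?_⟩
    exact_mod_cast z.val_lt
  set w : ZMod p × ZMod q → ℂ := fun r => χ₁⁻¹ r.1 * χ₂⁻¹ r.2 with hw
  have hH : ∀ r, w r ≠ 0 → SineIdentity k ν a x (r.1.val / p) (r.2.val / q) := by
    intro r hr
    have hr1 : r.1 ≠ 0 := fun h => hr (by simp [hw, h, o1.inv.map_zero])
    have hr2 : r.2 ≠ 0 := fun h => hr (by simp [hw, h, o2.inv.map_zero])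
    exact H _ _ (hpt hr1).1 (hpt hr1).2 (hpt hr2).1 (hpt hr2).2
  have hτ1 := tauSum_inv_ne_zero h1 o1
  have hτ2 := tauSum_inv_ne_zero h2 o2
  have hL := hasSum_sum_mul_of_ne_zero fun r hr => (hH r hr).1
  have hR := hasSum_sum_mul_of_ne_zero fun r hr => (hH r hr).2.1
  set L := ∑ r, w r * ∑' n : ℕ+, ((n : ℕ) : ℂ) ^ (ν / 2) *
    besselK ν ((a * Real.sqrt ((n : ℕ) * x) : ℝ) : ℂ) *
      (sinSinDivisorSum k (r.1.val / p) (r.2.val / q) n : ℂ) with hLdef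
  set R := ∑ r, w r * ∑' i : ℕ × ℕ, signedTerm k ν a x (r.1.val / p) (r.2.val / q) i.1 i.2
    with hRdef
  set τ := tauSum χ₁⁻¹ * tauSum χ₂⁻¹ with hτ
  have hτ0 : -τ ≠ 0 := neg_ne_zero.2 (mul_ne_zero hτ1 hτ2)
  have hX : HasSum (fun n : ℕ+ => twistedSigma k χ₁ χ₂ n * ((n : ℕ) : ℂ) ^ (ν / 2) *
      besselK ν ((a * Real.sqrt ((n : ℕ) * x) : ℝ) : ℂ)) ((-τ)⁻¹ * L) := by
    refine (hL.mul_left (-τ)⁻¹).congr_fun fun n => ?_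
    rw [eq_inv_mul_iff_mul_eq₀ hτ0, ← mul_assoc, ← mul_assoc,
      ← sum_inv_mul_sinSinDivisorSum h1 h2 o1 o2, Finset.sum_mul, Finset.sum_mul]
    refine Finset.sum_congr rfl fun r _ => ?_
    simp only [hw]
    ring
  have hS := (summable_twistedRieszTerm (k := k) hν ha hx χ₁ χ₂).hasSum
  set S := ∑' i : ℕ+ × ℕ+, twistedRieszTerm k ν a x χ₁ χ₂ i.1 i.2 with hSdef
  have hRS : R = 4 * ((q : ℂ) ^ k)⁻¹ * S := by
    refine hR.unique (((hasSum_twistedRieszTerm_nat o1 o2 hS).mul_left _).congr_fun fun i => ?_)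
    exact sum_inv_mul_signedTerm o1 o2 ν a x i.1 i.2
  have hY : HasSum (fun n : ℕ+ => twistedSigma k (star χ₂) (star χ₁) n * (Gamma (ν + k + 1) /
      ((16 * Real.pi ^ 2 / (a ^ 2 * p * q) * ((n : ℕ) / x) + 1 : ℝ) : ℂ) ^ (ν + k + 1)))
      (Gamma (ν + k + 1) * S) :=
    (hS.sum_divisors_pnat.mul_left _).congr_fun fun n => twistedSigma_star_mul χ₁ χ₂ ν a x n
  have hLR : ((a ^ 2 * x / 4 : ℝ) : ℂ) ^ (ν / 2 + k + 1) * L =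
      -((-1) ^ ((k + 1) / 2) / 8) * (2 * (Real.pi : ℂ)) ^ (k + 1) * Gamma (ν + k + 1) * R := by
    rw [hLdef, hRdef, Finset.mul_sum, Finset.mul_sum]
    refine Finset.sum_congr rfl fun r _ => ?_
    rcases eq_or_ne (w r) 0 with h0 | h0
    · simp [h0]
    · have := (hH r h0).2.2
      linear_combination w r * this
  refine ⟨hX.summable, hY.summable, ?_⟩
  have t1 := tauSum_mul_tauSum_inv h1 o1
  have t2 := tauSum_mul_tauSum_inv h2 o2
  rw [hX.tsum_eq, hY.tsum_eq, mul_left_comm, inv_mul_eq_iff_eq_mul₀ hτ0, hLR, hRS]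
  -- This trades division by the Gauss sums of the inverse characters for multiplication by those of
  -- χ₁ and χ₂; with 4q^(-k) and -1/8 it yields the constant (2π/q)^(k+1)/(2p).
  have t3 : tauSum χ₁ * tauSum χ₂ * τ = p * q := by
    rw [hτ]
    linear_combination (tauSum χ₂ * tauSum χ₂⁻¹) * t1 - (p : ℂ) * t2
  have t4 : -τ * ((-1) ^ ((k + 1) / 2) / (2 * (p : ℂ)) * (2 * (Real.pi : ℂ) / q) ^ (k + 1) *
      tauSum χ₁ * tauSum χ₂ * (Gamma (ν + k + 1) * S)) =
      -((-1) ^ ((k + 1) / 2) / (2 * (p : ℂ)) * (2 * (Real.pi : ℂ) / q) ^ (k + 1) *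
      (p * q) * (Gamma (ν + k + 1) * S)) := by
    rw [← t3]
    ring
  rw [t4, div_pow, pow_succ (q : ℂ)]
  field_simp
  norm_num
  exact Or.inl (by ring)

end

end

theorem theorem2p11 (k : ℕ) (hk : Odd k) (ν : ℂ) (hν : 0 < ν.re)
    (a x : ℝ) (ha : 0 < a) (hx : 0 < x) :
    (∀ θ ψ : ℝ, 0 < θ → θ < 1 → 0 < ψ → ψ < 1 → SineIdentity k ν a x θ ψ) ∧
    ((∀ θ ψ : ℝ, 0 < θ → θ < 1 → 0 < ψ → ψ < 1 → SineIdentity k ν a x θ ψ) ↔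
      (∀ (p q : ℕ) [NeZero p] [NeZero q]
        (χ₁ : DirichletCharacter ℂ p) (χ₂ : DirichletCharacter ℂ q),
        χ₁.IsPrimitive → χ₂.IsPrimitive → χ₁.Odd → χ₂.Odd →
        CharacterIdentity k ν a x χ₁ χ₂)) := by
  have H : ∀ θ ψ : ℝ, 0 < θ → θ < 1 → 0 < ψ → ψ < 1 → SineIdentity k ν a x θ ψ :=
    fun θ ψ h0 h1 h2 h3 => sineIdentity hk hν ha hx h0 h1 h2 h3
  -- Only the passage from sines to characters uses its premise; the reverse implication returns the
  -- sine identity already proved.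
  exact ⟨H, fun H p q _ _ χ₁ χ₂ h1 h2 o1 o2 =>
    characterIdentity_of_sineIdentity hν ha hx H h1 h2 o1 o2, fun _ => H⟩
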